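/- **Setting.** Let $a\in\mathbb R^d$, $z\ge 0$, and let $r$ be a probability measure on $\mathbb R^d\setminus\{0\}$ whose Fourier transform is analytic in a neighbourhood of $0$ (for instance entire). Put $$\Psi^{\rm jump}(-i\xi)=i\langle a,\xi\rangle+z\int(e^{i\langle y,\xi\rangle}-1)\,dr(y),\qquad C_{X_1\cdots X_n}=(-i)^n\frac{\partial^n}{\partial\xi_{X_1}\cdots\partial\xi_{X_n}}\Psi^{\rm jump}(-i\xi)\Big|_{\xi=0},$$ for $n\ge1$ and $X_1,\dots,X_n\in\{1,\dots,d\}$; these are real numbers (the joint cumulants of the jump process at unit time). For $\mu>0$ let $\Phi_t=\Phi^{(\mu)}_t$, $t>0$, be the density of the jump-diffusion Lévy process with drift $a$, diffusion matrix $\mu\cdot\mathrm{Id}$, jump rate $z$ and jump distribution $r$ started at $0$: each $\Phi_t$ is a continuous probability density on $\mathbb R^d$, and, in the sense of tempered distributions, $$\frac{\partial\Phi_t}{\partial t}(\phi)=\mu\Delta\Phi_t(\phi)-\sum_{X=1}^d a_X\frac{\partial\Phi_t}{\partial\phi_X}(\phi)+z\int[\Phi_t(\phi-y)-\Phi_t(\phi)]\,dr(y)\quad(t>0),\qquad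 \Phi_t\to\delta_0\quad(t\searrow0).$$ **Graphs.** $\bar Q(m)$ is the set of graphs (loops and multiple edges allowed) with $m$ numbered directed edges and with two types of vertices, inner empty and outer empty, such that every vertex is met by some edge and every outer empty vertex is met by exactly one end of one edge; vertices of the same type are indistinguishable. $\bar Q_c(m)$ is the subset of those graphs in which any two vertices are joined by a walk (along edges irrespective of direction). For $t>0$, $\phi\in\mathbb R^d$ and $G\in\bar Q(m)$ the number $\mathcal V[G](t,\phi)$ is obtained as follows: assign a value $X_e\in\{1,\dots,d\}$ to each edge $e$; multiply, for each outer empty vertex, with $-\phi_{X_e}$, where $e$ is the edge that meets it, and, for each inner empty vertex, with $t\,C_{X_{e_1}\cdots X_{e_l}}$, where $e_1,\dots,e_l$ are the edges that meet it (a loop being listed twice); sum over all assignments. **Theorem 3.1.** Fix $t>0$ and $\phi\in\mathbb R^d$, and for $\beta>0$ let $\Phi_t$ be taken with $\mu=1/(4\beta t)$, so that $\beta=1/(4\mu t)$. Then, in the sense of asymptotic series as $\beta\searrow0$ (large diffusion), $$\Big(\frac\beta\pi\Big)^{-d/2}\Phi_t(\phi)=\sum_{m=0}^\infty\frac{(-\beta)^m}{m!}\sum_{G\in\bar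 Q(m)}\mathcal V[G](t,\phi),$$ $$\log\Big[\Big(\frac\beta\pi\Big)^{-d/2}\Phi_t(\phi)\Big]=\sum_{m=1}^\infty\frac{(-\beta)^m}{m!}\sum_{G\in\bar Q_c(m)}\mathcal V[G](t,\phi).$$ Here $h(\beta)=\sum_{m}\beta^m c_m$ in the sense of asymptotic series means that $\lim_{\beta\searrow0}\beta^{-N}\big|h(\beta)-\sum_{m=0}^N\beta^m c_m\big|=0$ for every $N\in\mathbb N$. -/

import Mathlib

open MeasureTheory Filter Topology Finset
open scoped SchwartzMap

namespace LevyExpansion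

noncomputable section

/-- The symbol `ξ ↦ Ψ^jump(-iξ) = i⟨a, ξ⟩ + z ∫ (exp(i⟨y, ξ⟩) - 1) dr(y)` of the Lévy process with
drift `a`, jump rate `z` and jump distribution `r`, without its diffusion part. -/
def jumpSymbol {d : ℕ} (a : EuclideanSpace ℝ (Fin d)) (z : ℝ)
    (r : Measure (EuclideanSpace ℝ (Fin d))) (ξ : EuclideanSpace ℝ (Fin d)) : ℂ :=
  Complex.I * (inner ℝ a ξ : ℝ) +
    (z : ℂ) * ∫ y, (Complex.exp (Complex.I * (inner ℝ y ξ : ℝ)) - 1) ∂r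

/-- The coefficient `C_{X₁ … X_n}` of the symbol, that is, the joint cumulant (at unit time)
`(-i)^n ∂^n/∂ξ_{X₁}…∂ξ_{X_n} Ψ^jump(-iξ)` at `ξ = 0`; this number is real. -/
def coeff {d : ℕ} (a : EuclideanSpace ℝ (Fin d)) (z : ℝ)
    (r : Measure (EuclideanSpace ℝ (Fin d))) {n : ℕ} (X : Fin n → Fin d) : ℝ :=
  ((-Complex.I) ^ n *
    iteratedFDeriv ℝ n (jumpSymbol a z r) 0
      (fun k => EuclideanSpace.single (X k) (1 : ℝ))).re

/-- The formal adjoint of the generator `μΔ - a·∇ + z ∫ [Φ(· - y) - Φ] dr(y)`. -/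
def adjointGenerator {d : ℕ} (μ : ℝ) (a : EuclideanSpace ℝ (Fin d)) (z : ℝ)
    (r : Measure (EuclideanSpace ℝ (Fin d))) (h : EuclideanSpace ℝ (Fin d) → ℂ)
    (x : EuclideanSpace ℝ (Fin d)) : ℂ :=
  (μ : ℂ) * Laplacian.laplacian h x
    + ∑ X : Fin d, (a X : ℂ) * fderiv ℝ h x (EuclideanSpace.single X (1 : ℝ))
    + (z : ℂ) * ∫ y, (h (x + y) - h x) ∂r

/-- `Φ t x`, `t > 0`, is the density of the jump-diffusion process with diffusion matrix `μ · Id`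
started at `0`: a continuous probability density in `x` that solves, as a tempered distribution,
`∂_t Φ_t = μ Δ Φ_t - a · ∇ Φ_t + z ∫ [Φ_t(· - y) - Φ_t] dr(y)` with `Φ_0 = δ_0`. -/
structure IsJumpDiffusionDensity {d : ℕ} (μ : ℝ) (a : EuclideanSpace ℝ (Fin d)) (z : ℝ)
    (r : Measure (EuclideanSpace ℝ (Fin d))) (Φ : ℝ → EuclideanSpace ℝ (Fin d) → ℝ) : Prop where
  continuous : ∀ t, 0 < t → Continuous (Φ t)
  nonneg : ∀ t, 0 < t → ∀ x, 0 ≤ Φ t x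
  integrable : ∀ t, 0 < t → Integrable (Φ t)
  integral_eq_one : ∀ t, 0 < t → ∫ x, Φ t x = 1
  equation : ∀ h : 𝓢(EuclideanSpace ℝ (Fin d), ℂ), ∀ t, 0 < t →
    HasDerivAt (fun s => ∫ x, (Φ s x : ℂ) * h x)
      (∫ x, (Φ t x : ℂ) * adjointGenerator μ a z r h x) t
  initial : ∀ h : 𝓢(EuclideanSpace ℝ (Fin d), ℂ),
    Tendsto (fun t => ∫ x, (Φ t x : ℂ) * h x) (𝓝[>] (0 : ℝ)) (𝓝 (h 0))

/-- `∑ β^m c_m` is an asymptotic series (in the sense of Poincaré) of `f` as `β ↘ 0`. -/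
def IsAsymptoticSeries (f : ℝ → ℝ) (c : ℕ → ℝ) : Prop :=
  ∀ N : ℕ, Tendsto (fun β : ℝ => (β ^ N)⁻¹ * |f β - ∑ m ∈ range (N + 1), β ^ m * c m|)
    (𝓝[>] (0 : ℝ)) (𝓝 0)

/-- The ends of `m` directed edges: `(e, false)` is the tail of the edge `e`, `(e, true)` its head.
The edges are numbered by `Fin m`. -/
abbrev Leg (m : ℕ) : Type := Fin m × Bool

/-- Graphs with `m` numbered directed edges and with two types of vertices, inner empty and outer
empty, such that an outer empty vertex is hit by exactly one edge (and by one end of it only).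
Every vertex is met by some edge. Vertices of the same type are indistinguishable, so a vertex is
nothing but the set of edge ends that meet in it: the vertices form a partition of the edge ends.
Loops and multiple edges are allowed. -/
@[ext]
structure QGraph (m : ℕ) where
  /-- the vertices -/
  vertices : Finpartition (univ : Finset (Leg m))
  /-- the outer empty vertices -/
  outer : Finset (Finset (Leg m))
  outer_subset : outer ⊆ vertices.parts
  card_of_mem_outer : ∀ v ∈ outer, v.card = 1

namespace QGraph

variable {m : ℕ}

instance : Fintype (QGraph m) :=
  Fintype.ofInjective (fun G : QGraph m => (G.vertices, G.outer)) fun G H h => by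
    simp only [Prod.mk.injEq] at h
    exact QGraph.ext h.1 h.2

/-- The inner empty vertices. -/
def inner (G : QGraph m) : Finset (Finset (Leg m)) := G.vertices.parts \ G.outer

/-- Two distinct vertices are adjacent if some edge has one end in each of them. -/
def toSimpleGraph (G : QGraph m) : SimpleGraph {v // v ∈ G.vertices.parts} :=
  SimpleGraph.fromRel fun u v => ∃ e : Fin m, (e, false) ∈ u.1 ∧ (e, true) ∈ v.1

/-- Any two vertices are joined by a walk. -/
def IsConnected (G : QGraph m) : Prop := G.toSimpleGraph.Connected

/-- The Feynman rules: assign a value `X e ∈ {1, …, d}` to each edge `e`; for each outer empty vertex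
multiply with `-φ_X`, where `X` belongs to the edge that hits it; for each inner empty vertex with
`l` legs multiply with `t C_{X₁ … X_l}`, where `X₁, …, X_l` belong to its legs (repeated twice for
a loop; the order is immaterial since `C` is symmetric); sum over all assignments. -/
def value (G : QGraph m) {d : ℕ} (a : EuclideanSpace ℝ (Fin d)) (z : ℝ)
    (r : Measure (EuclideanSpace ℝ (Fin d))) (t : ℝ) (φ : EuclideanSpace ℝ (Fin d)) : ℝ :=
  ∑ X : Fin m → Fin d,
    (∏ v ∈ G.outer, ∏ l ∈ v, -φ (X l.1)) *
      ∏ v ∈ G.inner, t * coeff a z r (fun k : Fin v.card => X (v.equivFin.symm k).1.1)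

end QGraph

end

end LevyExpansion

/-! Fourier inversion turns the density into a Gaussian mean. The evolution equation forces the
Fourier transform of `Φ t` to be the exponential of `t` times the Lévy symbol
(`IsJumpDiffusionDensity.fourier_eq`). The diffusion part of the symbol is a Gaussian factor, and
for `μ = 1 / (4βt)` the rescaled density is the mean of `f = exp (phase)`, where `phase ξ = tΨ(ξ) -
i⟨φ, ξ⟩`, under the normalised Gaussian `exp (-‖ξ‖² / (4β))` (`rescaled_density_eq`). As `β ↘ 0`
this Gaussian concentrates at the origin, where `f` is analytic, while `|f| ≤ 1` everywhere. Taylor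
expansion and Gaussian integration by parts give the asymptotic series `∑ β^m / m! (Δ^m f)(0)`
(`exists_gaussian_expansion`).

The number `(Δ^m f)(0)` is a sum over graphs. Each Laplacian is an edge whose two ends carry the
same derivative, summed over its direction. The formula of Faà di Bruno for the exponential
(`legDeriv_cexp`) distributes the `2m` derivatives over the blocks of a partition of the edge ends;
the blocks are the vertices. Up to a factor `i` per leg, a block contributes `t C` from the jump
symbol and, if it has a single leg, also `-φ` from the linear term: the inner and the outer
vertices. The `2m` factors `i` make up the sign `(-1)^m`.

For the logarithm, splitting off the component of one edge yields the recursion `graphSum_succ`. It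
is the coefficient form of `A' = C' A` for the exponential generating functions `A` of all graphs
and `C` of the connected ones, so that `A = exp C` formally. Comparing truncations
(`isAsymptoticSeries_log`) carries this over to asymptotic series. -/

namespace LevyExpansion

open scoped ContDiff FourierTransform LineDeriv

/-! ### Weighted sums over set partitions. -/

section PartitionSums

variable {α R : Type*} [DecidableEq α] [CommRing R]

/-- The sum over all partitions of `S` of the product of the weights of the blocks. -/
def partitionSum (w : Finset α → R) (S : Finset α) : R :=
  ∑ P : Finpartition S, ∏ B ∈ P.parts, w B

@[simp]
theorem partitionSum_empty (w : Finset α → R) : partitionSum w ∅ = 1 := by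
  have h : ∀ P : Finpartition (∅ : Finset α), P.parts = ∅ := fun P => by
    rw [P.parts_eq_empty_iff]; rfl
  have : Unique (Finpartition (∅ : Finset α)) :=
    inferInstanceAs (Unique (Finpartition (⊥ : Finset α)))
  unfold partitionSum
  rw [Fintype.sum_unique, h]
  simp

/-- `V` is a union of blocks of the partition with the given blocks. -/
def Saturated (parts : Finset (Finset α)) (V : Finset α) : Prop :=
  ∀ B ∈ parts, B ⊆ V ∨ Disjoint B V

theorem parts_restrict_of_saturated {U V : Finset α} (P : Finpartition U) (hV : V ⊆ U)
    (h : Saturated P.parts V) :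
    (P.restrict (show V ≤ U from hV)).parts = P.parts.filter (· ⊆ V) := by
  ext B
  simp only [Finpartition.restrict, mem_erase, mem_image, mem_filter, Finset.inf_eq_inter,
    Finset.bot_eq_empty]
  constructor
  · rintro ⟨hne, C, hC, rfl⟩
    rcases h C hC with h1 | h1
    · rw [inter_eq_left.2 h1]; exact ⟨hC, h1⟩
    · exact absurd (disjoint_iff_inter_eq_empty.1 h1) hne
  · rintro ⟨hB, hBV⟩
    exact ⟨P.ne_bot hB, B, hB, inter_eq_left.2 hBV⟩

theorem parts_restrict_sdiff_of_saturated {U V : Finset α} (P : Finpartition U)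
    (h : Saturated P.parts V) :
    (P.restrict (show U \ V ≤ U from sdiff_subset)).parts = P.parts.filter (¬ · ⊆ V) := by
  have hs : Saturated P.parts (U \ V) := fun B hB => by
    rcases h B hB with h1 | h1
    · exact Or.inr (disjoint_sdiff.mono_left h1)
    · exact Or.inl (subset_sdiff.2 ⟨P.subset hB, h1⟩)
  rw [parts_restrict_of_saturated P sdiff_subset hs]
  refine filter_congr fun B hB => ?_
  constructor
  · intro h1 h2
    have := (subset_sdiff.1 h1).2
    exact P.ne_bot hB (disjoint_self.1 (this.mono_right h2))
  · intro h1
    exact subset_sdiff.2 ⟨P.subset hB, (h B hB).resolve_left h1⟩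

/-- A partition of `V` and a partition of `U \ V` form a partition of `U`. -/
def gluePartition {U V : Finset α} (hV : V ⊆ U) (P : Finpartition V) (Q : Finpartition (U \ V)) :
    Finpartition U where
  parts := P.parts ∪ Q.parts
  supIndep := by
    rw [supIndep_iff_pairwiseDisjoint]
    intro B hB C hC hBC
    rw [mem_coe, mem_union] at hB hC
    rcases hB with hB | hB <;> rcases hC with hC | hC
    · exact P.disjoint hB hC hBC
    · exact (disjoint_sdiff.mono (P.subset hB) (Q.subset hC))
    · exact (disjoint_sdiff.mono (P.subset hC) (Q.subset hB)).symm
    · exact Q.disjoint hB hC hBC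
  sup_parts := by
    rw [sup_union, P.sup_parts, Q.sup_parts]
    exact union_sdiff_of_subset hV
  bot_notMem := by
    rw [mem_union]
    exact fun h => h.elim P.bot_notMem Q.bot_notMem

theorem not_subset_of_mem_sdiff {U V : Finset α} (Q : Finpartition (U \ V)) {B : Finset α}
    (hB : B ∈ Q.parts) : ¬ B ⊆ V := fun h =>
  Q.ne_bot hB (disjoint_self.1 ((subset_sdiff.1 (Q.subset hB)).2.mono_right h))

theorem saturated_glue {U V : Finset α} (hV : V ⊆ U) (P : Finpartition V)
    (Q : Finpartition (U \ V)) : Saturated (gluePartition hV P Q).parts V := by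
  intro B hB
  rcases mem_union.1 hB with hB | hB
  · exact Or.inl (P.subset hB)
  · exact Or.inr (subset_sdiff.1 (Q.subset hB)).2

theorem filter_glue {U V : Finset α} (hV : V ⊆ U) (P : Finpartition V)
    (Q : Finpartition (U \ V)) : (gluePartition hV P Q).parts.filter (· ⊆ V) = P.parts := by
  change (P.parts ∪ Q.parts).filter _ = _
  rw [filter_union, filter_true_of_mem fun B hB => P.subset hB,
    filter_false_of_mem fun B hB => not_subset_of_mem_sdiff Q hB, union_empty]

theorem filter_not_glue {U V : Finset α} (hV : V ⊆ U) (P : Finpartition V)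
    (Q : Finpartition (U \ V)) : (gluePartition hV P Q).parts.filter (¬ · ⊆ V) = Q.parts := by
  change (P.parts ∪ Q.parts).filter _ = _
  rw [filter_union, filter_false_of_mem fun B hB => by simpa using P.subset hB,
    filter_true_of_mem fun B hB => not_subset_of_mem_sdiff Q hB, empty_union]

open Classical in
/-- Partitions of `U` that saturate `V` are pairs of a partition of `V` and one of `U \ V`. -/
theorem sum_saturated (w : Finset α → R) {U V : Finset α} (hV : V ⊆ U)
    (q : Finset (Finset α) → Prop) :
    ∑ P : Finpartition U with Saturated P.parts V ∧ q (P.parts.filter (· ⊆ V)),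
      ∏ B ∈ P.parts, w B =
    (∑ P : Finpartition V with q P.parts, ∏ B ∈ P.parts, w B) * partitionSum w (U \ V) := by
  rw [partitionSum, sum_mul_sum, ← sum_product']
  refine sum_bij' (fun P _ => (P.restrict (show V ≤ U from hV),
      P.restrict (show U \ V ≤ U from sdiff_subset))) (fun x _ => gluePartition hV x.1 x.2)
    ?_ ?_ ?_ ?_ ?_
  · intro P hP
    rw [mem_filter] at hP
    simp only [mem_product, mem_filter, mem_univ, true_and, and_true]
    rw [parts_restrict_of_saturated P hV hP.2.1]
    exact hP.2.2
  · rintro ⟨P, Q⟩ h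
    simp only [mem_product, mem_filter, mem_univ, true_and, and_true] at h ⊢
    refine ⟨saturated_glue hV P Q, ?_⟩
    rw [filter_glue]
    exact h
  · intro P hP
    rw [mem_filter] at hP
    apply Finpartition.ext
    change _ ∪ _ = _
    rw [parts_restrict_of_saturated P hV hP.2.1, parts_restrict_sdiff_of_saturated P hP.2.1]
    exact filter_union_filter_not_eq _ _
  · rintro ⟨P, Q⟩ _
    refine Prod.ext (Finpartition.ext ?_) (Finpartition.ext ?_)
    · exact (parts_restrict_of_saturated _ hV (saturated_glue hV P Q)).trans (filter_glue hV P Q)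
    · exact (parts_restrict_sdiff_of_saturated _ (saturated_glue hV P Q)).trans
        (filter_not_glue hV P Q)
  · intro P hP
    rw [mem_filter] at hP
    change _ = (∏ B ∈ (P.restrict (show V ≤ U from hV)).parts, w B) *
      ∏ B ∈ (P.restrict (show U \ V ≤ U from sdiff_subset)).parts, w B
    rw [parts_restrict_of_saturated P hV hP.2.1, parts_restrict_sdiff_of_saturated P hP.2.1]
    exact (prod_filter_mul_prod_filter_not _ _ _).symm

open Classical in
theorem sum_partition_singleton (w : Finset α → R) {V : Finset α} (hV : V.Nonempty) :
    ∑ P : Finpartition V with P.parts = {V}, ∏ B ∈ P.parts, w B = w V := by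
  rw [sum_eq_single_of_mem (Finpartition.indiscrete hV.ne_empty)]
  · simp
  · simp
  · intro P hP hne
    exact absurd (Finpartition.ext (by simpa using hP)) hne

/-- Partitions are sorted by the block `insert x T` of `x`; what remains is an arbitrary partition
of `S \ T`. With the value at `∅` this recursion characterises `partitionSum`, so later identities
only have to verify it. -/
theorem partitionSum_insert (w : Finset α → R) {x : α} {S : Finset α} (hx : x ∉ S) :
    partitionSum w (insert x S) =
      ∑ T ∈ S.powerset, w (insert x T) * partitionSum w (S \ T) := by
  classical
  have key : ∀ T ∈ S.powerset, w (insert x T) * partitionSum w (S \ T) =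
      ∑ P : Finpartition (insert x S) with insert x T ∈ P.parts, ∏ B ∈ P.parts, w B := by
    intro T hT
    have hV : insert x T ⊆ insert x S := insert_subset_insert x (mem_powerset.1 hT)
    have hd : insert x S \ insert x T = S \ T := by
      rw [insert_sdiff_insert, sdiff_insert_of_notMem hx]
    have := sum_saturated w hV (fun Q => Q = {insert x T})
    have hs : (∑ P : Finpartition (insert x T) with P.parts = {insert x T},
        ∏ B ∈ P.parts, w B) = w (insert x T) := by
      convert! sum_partition_singleton w (insert_nonempty x T)
    rw [hd] at this
    rw [← hs]
    convert! this.symm using 1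
    · congr!
    congr 1
    ext P
    simp only [mem_filter, mem_univ, true_and]
    symm
    constructor
    · rintro ⟨-, h⟩
      have : insert x T ∈ P.parts.filter (· ⊆ insert x T) := by rw [h]; simp
      exact (mem_filter.1 this).1
    · intro h
      have hsat : ∀ B ∈ P.parts, B = insert x T ∨ Disjoint B (insert x T) := fun B hB => by
        by_cases hB' : B = insert x T
        · exact Or.inl hB'
        · exact Or.inr (P.disjoint hB h hB')
      refine ⟨fun B hB => (hsat B hB).imp_left fun h => h.le, ?_⟩
      ext B
      simp only [mem_filter, mem_singleton]
      constructor
      · rintro ⟨hB, hBT⟩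
        exact (hsat B hB).resolve_right fun hd => P.ne_bot hB (disjoint_self.1 (hd.mono_right hBT))
      · rintro rfl
        exact ⟨h, subset_rfl⟩
  rw [sum_congr rfl key]
  simp_rw [sum_filter]
  rw [sum_comm, partitionSum]
  refine sum_congr rfl fun P _ => ?_
  have hmem : P.part x ∈ P.parts := P.part_mem.2 (mem_insert_self x S)
  have hxm : x ∈ P.part x := P.mem_part_self.2 (mem_insert_self x S)
  rw [sum_eq_single_of_mem ((P.part x).erase x), if_pos (by rwa [insert_erase hxm])]
  · rw [mem_powerset]
    intro y hy
    rw [mem_erase] at hy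
    exact (mem_insert.1 (P.part_subset x hy.2)).resolve_left hy.1
  · intro T hT hne
    rw [if_neg]
    intro h
    apply hne
    rw [P.part_eq_of_mem h (mem_insert_self x T), erase_insert]
    exact fun hxT => hx (mem_powerset.1 hT hxT)

/-- The recursion determines the partition sum. -/
theorem eq_partitionSum_of_recursion {w Z : Finset α → R} (h0 : Z ∅ = 1)
    (h : ∀ (x : α) (S : Finset α), x ∉ S →
      Z (insert x S) = ∑ T ∈ S.powerset, w (insert x T) * Z (S \ T)) (S : Finset α) :
    Z S = partitionSum w S := by
  induction S using Finset.strongInduction with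
  | H S ih =>
    rcases S.eq_empty_or_nonempty with rfl | ⟨x, hx⟩
    · rw [h0, partitionSum_empty]
    · rw [← insert_erase hx, h x _ (notMem_erase x S), partitionSum_insert w (notMem_erase x S)]
      refine sum_congr rfl fun T hT => ?_
      rw [ih _ ((sdiff_subset).trans_ssubset (erase_ssubset hx))]

/-- Going through the recursion avoids pushing partitions forward along `f`. -/
theorem partitionSum_map {β : Type*} [DecidableEq β] (f : β ↪ α) (w : Finset α → R)
    (S : Finset β) : partitionSum w (S.map f) = partitionSum (fun B => w (B.map f)) S := by
  refine eq_partitionSum_of_recursion (Z := fun S => partitionSum w (S.map f)) (by simp) ?_ S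
  intro x S hx
  simp only [map_insert]
  rw [partitionSum_insert w (by simpa using hx)]
  rw [show (S.map f).powerset = S.powerset.map ⟨fun T => T.map f, map_injective f⟩ by
    ext T; simp [Finset.mem_map, subset_map_iff, eq_comm], sum_map]
  simp [Finset.map_sdiff]

theorem partitionSum_congr {w w' : Finset α → R} {S : Finset α}
    (h : ∀ B ⊆ S, B.Nonempty → w B = w' B) : partitionSum w S = partitionSum w' S :=
  sum_congr rfl fun P _ => prod_congr rfl fun _ hB =>
    h _ (P.subset hB) (P.nonempty_of_mem_parts hB)

theorem partitionSum_pow_card_mul (c : R) (w : Finset α → R) (S : Finset α) :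
    partitionSum (fun B => c ^ B.card * w B) S = c ^ S.card * partitionSum w S := by
  simp only [partitionSum, mul_sum, prod_mul_distrib, prod_pow_eq_pow_sum,
    Finpartition.sum_card_parts]

end PartitionSums

/-! ### Components of graphs given as partitions of edge ends. -/

section LinkedCluster

variable {E R : Type*} [CommRing R]

/-- The edge ends of a set of edges. -/
def legs (S : Finset E) : Finset (E × Bool) := S ×ˢ univ

@[simp]
theorem mem_legs {S : Finset E} {l : E × Bool} : l ∈ legs S ↔ l.1 ∈ S := by
  simp [legs]

theorem legs_subset {S T : Finset E} : legs S ⊆ legs T ↔ S ⊆ T := by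
  constructor
  · intro h e he
    simpa using h (show (e, true) ∈ legs S by simpa)
  · intro h l hl
    rw [mem_legs] at hl ⊢
    exact h hl

theorem map_legs {F : Type*} (f : F ↪ E) (S : Finset F) :
    legs (S.map f) = (legs S).map (f.prodMap (Function.Embedding.refl Bool)) := by
  ext ⟨e, b⟩
  simp

variable [DecidableEq E]

theorem legs_sdiff (S T : Finset E) : legs (S \ T) = legs S \ legs T := by
  ext l; simp

/-- A graph, given by its vertices, on the set `S` of edges is linked if no nonempty proper subset
of `S` is a union of components. -/
def Linked (S : Finset E) (parts : Finset (Finset (E × Bool))) : Prop :=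
  ∀ T ⊆ S, T.Nonempty → Saturated parts (legs T) → T = S

open Classical in
/-- The sum over the linked graphs on the set `S` of edges of the product of the weights of the
vertices. -/
noncomputable def linkedSum (w : Finset (E × Bool) → R) (S : Finset E) : R :=
  ∑ P : Finpartition (legs S) with Linked S P.parts, ∏ B ∈ P.parts, w B


open Classical in
/-- The edges of the component of the edge `e`. -/
noncomputable def component (S : Finset E) (parts : Finset (Finset (E × Bool))) (e : E) :
    Finset E :=
  S.filter fun e' => ∀ T ⊆ S, e ∈ T → Saturated parts (legs T) → e' ∈ T

theorem mem_component {S : Finset E} {parts : Finset (Finset (E × Bool))} {e e' : E} :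
    e' ∈ component S parts e ↔
      e' ∈ S ∧ ∀ T ⊆ S, e ∈ T → Saturated parts (legs T) → e' ∈ T := by
  simp [component]

theorem component_subset (S : Finset E) (parts : Finset (Finset (E × Bool))) (e : E) :
    component S parts e ⊆ S :=
  fun _ h => (mem_component.1 h).1

theorem component_subset_of_saturated {S T : Finset E} {parts : Finset (Finset (E × Bool))}
    {e : E} (hT : T ⊆ S) (he : e ∈ T) (h : Saturated parts (legs T)) :
    component S parts e ⊆ T := fun _ h' => (mem_component.1 h').2 T hT he h

theorem mem_component_self {S : Finset E} {parts : Finset (Finset (E × Bool))} {e : E}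
    (he : e ∈ S) : e ∈ component S parts e :=
  mem_component.2 ⟨he, fun _ _ h _ => h⟩

/-- The component is the intersection of all saturated edge sets that contain `e`. A block meeting
it meets each of these sets, hence lies in each of them. -/
theorem saturated_component {S : Finset E} (P : Finpartition (legs S)) (e : E) :
    Saturated P.parts (legs (component S P.parts e)) := by
  intro B hB
  by_contra! h
  obtain ⟨h1, h2⟩ := h
  obtain ⟨l, hl, hlK⟩ := not_disjoint_iff.1 h2
  obtain ⟨l', hl', hlK'⟩ := not_subset.1 h1
  rw [mem_legs] at hlK hlK'
  apply hlK'
  refine mem_component.2 ⟨mem_legs.1 (P.subset hB hl'), fun T hT he hs => ?_⟩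
  rcases hs B hB with h3 | h3
  · exact mem_legs.1 (h3 hl')
  · exact absurd (mem_legs.2 ((mem_component.1 hlK).2 T hT he hs)) (disjoint_left.1 h3 hl)

/-- Let `T` be a nonempty saturated part of the component `K`. If `e ∈ T`, minimality of `K` gives
`T = K`. Otherwise `K \ T` is saturated and contains `e`, so minimality leaves nothing for `T`. -/
theorem linked_component {S : Finset E} (P : Finpartition (legs S)) {e : E} (he : e ∈ S) :
    Linked (component S P.parts e)
      (P.parts.filter (· ⊆ legs (component S P.parts e))) := by
  set K := component S P.parts e with hK
  have lift : ∀ T ⊆ K, Saturated (P.parts.filter (· ⊆ legs K)) (legs T) →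
      Saturated P.parts (legs T) := by
    intro T hT hs B hB
    rcases saturated_component P e B hB with h | h
    · exact hs B (mem_filter.2 ⟨hB, h⟩)
    · exact Or.inr (h.mono_right (legs_subset.2 hT))
  have hKS : K ⊆ S := component_subset _ _ _
  intro T hT hne hs
  by_cases heT : e ∈ T
  · exact hT.antisymm (component_subset_of_saturated (hT.trans hKS) heT (lift T hT hs))
  · exfalso
    have hs' : Saturated (P.parts.filter (· ⊆ legs K)) (legs (K \ T)) := by
      intro B hB
      rw [legs_sdiff]
      rcases hs B hB with h | h
      · exact Or.inr (disjoint_sdiff.mono_left h)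
      · exact Or.inl (subset_sdiff.2 ⟨(mem_filter.1 hB).2, h⟩)
    have := component_subset_of_saturated (sdiff_subset.trans hKS)
      (mem_sdiff.2 ⟨mem_component_self he, heT⟩) (lift _ sdiff_subset hs')
    obtain ⟨x, hx⟩ := hne
    exact (mem_sdiff.1 (this (hT hx))).2 hx

/-- Brings the condition into the shape required by `sum_saturated`: saturation, and a property of
the blocks inside `T` alone. -/
theorem eq_component_iff {S T : Finset E} (P : Finpartition (legs S)) {e : E} (hT : T ⊆ S)
    (he : e ∈ T) : T = component S P.parts e ↔
      Saturated P.parts (legs T) ∧ Linked T (P.parts.filter (· ⊆ legs T)) := by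
  constructor
  · rintro rfl
    exact ⟨saturated_component P e, linked_component P (hT he)⟩
  · rintro ⟨hs, hl⟩
    refine (hl _ (component_subset_of_saturated hT he hs) ⟨e, mem_component_self (hT he)⟩ ?_).symm
    exact fun B hB => saturated_component P e B (mem_filter.1 hB).1

/-- **Linked cluster recursion**: split off the component of an edge. -/
theorem partitionSum_legs_insert (w : Finset (E × Bool) → R) {e : E} {S : Finset E}
    (he : e ∉ S) : partitionSum w (legs (insert e S)) =
      ∑ T ∈ S.powerset, linkedSum w (insert e T) * partitionSum w (legs (S \ T)) := by
  classical
  have key : ∀ T ∈ S.powerset, linkedSum w (insert e T) * partitionSum w (legs (S \ T)) =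
      ∑ P : Finpartition (legs (insert e S)) with
        insert e T = component (insert e S) P.parts e, ∏ B ∈ P.parts, w B := by
    intro T hT
    have hV : insert e T ⊆ insert e S := insert_subset_insert e (mem_powerset.1 hT)
    have hd : legs (S \ T) = legs (insert e S) \ legs (insert e T) := by
      rw [← legs_sdiff, insert_sdiff_insert, sdiff_insert_of_notMem he]
    rw [hd, linkedSum, ← sum_saturated w (legs_subset.2 hV)]
    refine sum_congr (filter_congr fun P _ => ?_) fun _ _ => rfl
    rw [eq_component_iff P hV (mem_insert_self e T)]
  rw [sum_congr rfl key]
  simp_rw [sum_filter]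
  rw [sum_comm, partitionSum]
  refine sum_congr rfl fun P _ => ?_
  have heK : e ∈ component (insert e S) P.parts e := mem_component_self (mem_insert_self e S)
  rw [sum_eq_single_of_mem ((component (insert e S) P.parts e).erase e),
    if_pos (by rw [insert_erase heK])]
  · rw [mem_powerset]
    intro y hy
    rw [mem_erase] at hy
    exact (mem_insert.1 (component_subset _ _ _ hy.2)).resolve_left hy.1
  · intro T hT hne
    rw [if_neg]
    intro h
    apply hne
    rw [← h, erase_insert]
    exact fun h' => he (mem_powerset.1 hT h')

/-- The recursion solved for its term `T = S`, where the other factor is the partition sum of the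
empty set. Linked sums are thereby determined by partition sums. -/
theorem linkedSum_insert (w : Finset (E × Bool) → R) {e : E} {S : Finset E}
    (he : e ∉ S) : linkedSum w (insert e S) = partitionSum w (legs (insert e S)) -
      ∑ T ∈ S.powerset.erase S, linkedSum w (insert e T) * partitionSum w (legs (S \ T)) := by
  rw [partitionSum_legs_insert w he, ← add_sum_erase _ _ (mem_powerset_self S)]
  simp [legs]

/-- Strong induction on the solved recursion reduces this to `partitionSum_map`; nonemptiness of `S`
supplies the edge at which the recursion is unfolded. -/
theorem linkedSum_map {F : Type*} [DecidableEq F] (f : F ↪ E) (w : Finset (E × Bool) → R)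
    {S : Finset F} (hS : S.Nonempty) : linkedSum w (S.map f) =
      linkedSum (fun B => w (B.map (f.prodMap (Function.Embedding.refl Bool)))) S := by
  induction S using Finset.strongInduction with
  | H S ih =>
    obtain ⟨e, he⟩ := hS
    obtain ⟨S', he', rfl⟩ : ∃ S', e ∉ S' ∧ S = insert e S' :=
      ⟨S.erase e, notMem_erase e S, (insert_erase he).symm⟩
    rw [map_insert, linkedSum_insert _ (by simpa using he'), linkedSum_insert _ he', ← map_insert,
      map_legs, partitionSum_map]
    congr 1
    rw [show (S'.map f).powerset.erase (S'.map f) =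
        (S'.powerset.erase S').map ⟨fun T => T.map f, map_injective f⟩ by
      ext T
      simp only [mem_erase, mem_powerset, Finset.mem_map, subset_map_iff, Function.Embedding.coeFn_mk]
      constructor
      · rintro ⟨h, T, hT, rfl⟩
        exact ⟨T, ⟨fun h' => h (by rw [h']), hT⟩, rfl⟩
      · rintro ⟨T, ⟨h, hT⟩, rfl⟩
        exact ⟨fun h' => h (map_injective f h'), T, hT, rfl⟩, sum_map]
    refine sum_congr rfl fun T hT => ?_
    rw [mem_erase, mem_powerset] at hT
    simp only [Function.Embedding.coeFn_mk]
    rw [← map_insert, ih (insert e T) ?_ (insert_nonempty e T), ← Finset.map_sdiff, map_legs,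
      partitionSum_map]
    exact (insert_subset_insert e hT.2).ssubset_of_ne fun h => hT.1 (by
      rw [← erase_insert he', ← h, erase_insert fun h' => he' (hT.2 h')])

end LinkedCluster

/-! ### The linked cluster theorem for graphs with summed edge labels. -/

section EdgeLabels

variable {ι R : Type*} [Fintype ι] [CommRing R]
  (w : ∀ {E : Type} [DecidableEq E], (E → ι) → Finset (E × Bool) → R)

/-- The sum over all graphs with `m` numbered edges and over all assignments of a label to each
edge of the product of the weights of the vertices. -/
def graphSum (m : ℕ) : R := ∑ X : Fin m → ι, partitionSum (w X) (legs univ)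

/-- The sum over all linked graphs with `m` numbered edges and over all assignments of a label to
each edge of the product of the weights of the vertices. -/
noncomputable def linkedGraphSum (m : ℕ) : R := ∑ X : Fin m → ι, linkedSum (w X) univ

theorem sum_mul_of_split {E : Type*} [Fintype E] [DecidableEq E] (p : E → Prop) [DecidablePred p]
    (F : ({x // p x} → ι) → R) (G : ({x // ¬ p x} → ι) → R) :
    ∑ X : E → ι, F (fun i => X i) * G (fun i => X i) = (∑ X, F X) * ∑ X, G X := by
  rw [sum_mul_sum, ← sum_product']
  exact Fintype.sum_equiv (Equiv.piEquivPiSubtypeProd p fun _ => ι) _ _ fun _ => rfl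

theorem univ_map_subtype_eq {E : Type*} [Fintype E] (p : E → Prop) [DecidablePred p] :
    (univ : Finset {x // p x}).map (Function.Embedding.subtype p) = univ.filter p := by
  ext; simp

variable {w} (hw : ∀ {E F : Type} [DecidableEq E] [DecidableEq F] (f : F ↪ E) (X : E → ι)
  (B : Finset (F × Bool)),
  w X (B.map (f.prodMap (Function.Embedding.refl Bool))) = w (X ∘ f) B)

include hw

-- A subgraph is treated as a graph on the subtype of its own edges. This is why `w` is given for
-- all edge types at once and why `hw` demands that it ignore the names of the edges.
omit [Fintype ι] in
theorem partitionSum_legs_filter {E : Type} [Fintype E] [DecidableEq E] (X : E → ι) (p : E → Prop)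
    [DecidablePred p] : partitionSum (w X) (legs (univ.filter p)) =
      partitionSum (w fun i : {x // p x} => X i) (legs univ) := by
  rw [← univ_map_subtype_eq, map_legs, partitionSum_map]
  congr 1
  ext B
  exact hw _ X B

omit [Fintype ι] in
theorem linkedSum_filter {E : Type} [Fintype E] [DecidableEq E] (X : E → ι) (p : E → Prop)
    [DecidablePred p] (h : ∃ x, p x) : linkedSum (w X) (univ.filter p) =
      linkedSum (w fun i : {x // p x} => X i) univ := by
  obtain ⟨x, hx⟩ := h
  rw [← univ_map_subtype_eq, linkedSum_map _ _ ⟨⟨x, hx⟩, mem_univ _⟩]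
  congr 1
  ext B
  exact hw _ X B

theorem sum_partitionSum_eq_graphSum {E : Type} [Fintype E] [DecidableEq E] :
    ∑ X : E → ι, partitionSum (w X) (legs univ) = graphSum w (Fintype.card E) := by
  let e := Fintype.equivFin E
  refine Fintype.sum_equiv (e.arrowCongr (Equiv.refl ι)) _ _ fun X => ?_
  rw [← map_univ_equiv e, map_legs, partitionSum_map]
  congr 1
  ext B
  refine Eq.trans ?_ (hw e.toEmbedding _ B).symm
  congr 1
  ext i
  simp

theorem sum_linkedSum_eq_linkedGraphSum {E : Type} [Fintype E] [DecidableEq E] [Nonempty E] :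
    ∑ X : E → ι, linkedSum (w X) univ = linkedGraphSum w (Fintype.card E) := by
  let e := Fintype.equivFin E
  refine Fintype.sum_equiv (e.arrowCongr (Equiv.refl ι)) _ _ fun X => ?_
  rw [← map_univ_equiv e, linkedSum_map _ _ univ_nonempty]
  congr 1
  ext B
  refine Eq.trans ?_ (hw e.toEmbedding _ B).symm
  congr 1
  ext i
  simp

/-- **Linked cluster theorem**, as a recursion. -/
theorem graphSum_succ (n : ℕ) : graphSum w (n + 1) =
    ∑ k ∈ range (n + 1), (n.choose k : R) * (linkedGraphSum w (k + 1) * graphSum w (n - k)) := by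
  have h0 : (univ : Finset (Fin (n + 1))) = insert 0 (univ.erase 0) :=
    (insert_erase (mem_univ _)).symm
  have hcard : (univ.erase (0 : Fin (n + 1))).card = n := by simp
  have step : ∀ T ∈ (univ.erase (0 : Fin (n + 1))).powerset,
      ∑ X : Fin (n + 1) → ι, linkedSum (w X) (insert 0 T) *
        partitionSum (w X) (legs (univ.erase 0 \ T)) =
      linkedGraphSum w (T.card + 1) * graphSum w (n - T.card) := by
    intro T hT
    rw [mem_powerset] at hT
    have h0T : (0 : Fin (n + 1)) ∉ T := fun h => by simpa using hT h
    obtain ⟨p, hp⟩ : ∃ p : Fin (n + 1) → Prop, ∀ x, p x ↔ x ∈ insert 0 T :=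
      ⟨fun x => x ∈ insert 0 T, fun _ => Iff.rfl⟩
    classical
    have h1 : insert 0 T = univ.filter p := by ext; simp [hp]
    have h2 : univ.erase 0 \ T = univ.filter (¬ p ·) := by ext; simp [hp]
    have hp0 : p 0 := (hp 0).2 (mem_insert_self 0 T)
    have c1 : Fintype.card {x // p x} = T.card + 1 := by
      rw [Fintype.card_subtype, ← h1, card_insert_of_notMem h0T]
    have c2 : Fintype.card {x // ¬ p x} = n - T.card := by
      rw [Fintype.card_subtype_compl, c1, Fintype.card_fin]
      omega
    have : Nonempty {x // p x} := ⟨⟨0, hp0⟩⟩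
    rw [← c1, ← c2, ← sum_linkedSum_eq_linkedGraphSum hw, ← sum_partitionSum_eq_graphSum hw,
      ← sum_mul_of_split]
    refine sum_congr rfl fun X _ => ?_
    rw [h2, h1, partitionSum_legs_filter hw, linkedSum_filter hw _ _ ⟨0, hp0⟩]
  rw [graphSum, h0]
  simp_rw [partitionSum_legs_insert _ (notMem_erase (0 : Fin (n + 1)) univ)]
  -- `T` collects the other edges in the component of edge `0`. Only its size `k` matters, and `n`
  -- choose `k` subsets have that size.
  rw [sum_comm, sum_congr rfl step,
    sum_powerset_apply_card fun k => linkedGraphSum w (k + 1) * graphSum w (n - k), hcard]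
  simp [graphSum, nsmul_eq_mul]

end EdgeLabels

/-! ### Graphs as partitions with marked singleton blocks; connectedness. -/

namespace QGraph

variable {m : ℕ}

theorem sum_eq_sum_vertices {R : Type*} [AddCommMonoid R] (q : QGraph m → Prop) [DecidablePred q]
    (q' : Finpartition (univ : Finset (Leg m)) → Prop) [DecidablePred q']
    (hq : ∀ G : QGraph m, q G ↔ q' G.vertices)
    (F : Finpartition (univ : Finset (Leg m)) → Finset (Finset (Leg m)) → R) :
    ∑ G : QGraph m with q G, F G.vertices G.outer =
      ∑ P : Finpartition (univ : Finset (Leg m)) with q' P,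
        ∑ O ∈ P.parts.powerset with ∀ v ∈ O, v.card = 1, F P O := by
  rw [sum_sigma']
  refine sum_bij' (fun G _ => ⟨G.vertices, G.outer⟩)
    (fun x hx => ⟨x.1, x.2, mem_powerset.1 (mem_filter.1 (mem_sigma.1 hx).2).1,
      (mem_filter.1 (mem_sigma.1 hx).2).2⟩) ?_ ?_ ?_ ?_ ?_
  · intro G hG
    rw [mem_filter] at hG
    simp only [mem_sigma, mem_filter, mem_univ, true_and, mem_powerset]
    exact ⟨(hq G).1 hG.2, G.outer_subset, G.card_of_mem_outer⟩
  · intro x hx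
    rw [mem_filter]
    refine ⟨mem_univ _, (hq _).2 ?_⟩
    exact (mem_filter.1 (mem_sigma.1 hx).1).2
  · intro G _; rfl
  · intro x _; rfl
  · intro G _; rfl

/-- Expanding the product on the right lets every vertex choose its type; the zero forbids the outer
type for vertices with several legs. -/
theorem sum_outer {R : Type*} [CommRing R] (s : Finset (Finset (Leg m)))
    (f g : Finset (Leg m) → R) :
    ∑ O ∈ s.powerset with ∀ v ∈ O, v.card = 1, (∏ v ∈ O, f v) * ∏ v ∈ s \ O, g v =
      ∏ v ∈ s, ((if v.card = 1 then f v else 0) + g v) := by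
  rw [prod_add, sum_filter]
  refine sum_congr rfl fun O _ => ?_
  split_ifs with h
  · rw [prod_congr rfl fun v hv => (if_pos (h v hv)).symm]
  · push Not at h
    obtain ⟨v, hv, h1⟩ := h
    rw [prod_eq_zero hv (if_neg h1), zero_mul]

/-- Saturated edge sets are those that no walk leaves. The case `m = 0` is excluded because the
graph without vertices is vacuously linked, but not connected. -/
theorem isConnected_iff_linked (hm : 0 < m) (G : QGraph m) :
    G.IsConnected ↔ Linked univ G.vertices.parts := by
  have : Nonempty {v // v ∈ G.vertices.parts} := by
    obtain ⟨v, hv, -⟩ := G.vertices.exists_mem (mem_univ ((⟨0, hm⟩ : Fin m), true))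
    exact ⟨⟨v, hv⟩⟩
  constructor
  · intro hG T _ ⟨e, he⟩ hs
    obtain ⟨v₀, hv₀, hev₀⟩ := G.vertices.exists_mem (mem_univ (e, true))
    have hsub : ∀ v ∈ G.vertices.parts, ∀ l ∈ v, l.1 ∈ T → v ⊆ legs T := fun v hv l hl hlT =>
      (hs v hv).resolve_right fun h => disjoint_left.1 h hl (mem_legs.2 hlT)
    have key : ∀ u v : {v // v ∈ G.vertices.parts}, G.toSimpleGraph.Walk u v →
        u.1 ⊆ legs T → v.1 ⊆ legs T := by
      intro u v p
      induction p with
      | nil => exact id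
      | cons h p ih =>
        intro hu
        apply ih
        rw [toSimpleGraph, SimpleGraph.fromRel_adj] at h
        rcases h.2 with ⟨e, h1, h2⟩ | ⟨e, h1, h2⟩
        · exact hsub _ (Subtype.prop _) _ h2 (show e ∈ T from mem_legs.1 (hu h1))
        · exact hsub _ (Subtype.prop _) _ h1 (show e ∈ T from mem_legs.1 (hu h2))
    rw [eq_univ_iff_forall]
    intro e'
    obtain ⟨v, hv, hev⟩ := G.vertices.exists_mem (mem_univ (e', true))
    obtain ⟨p⟩ := hG.preconnected ⟨v₀, hv₀⟩ ⟨v, hv⟩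
    exact mem_legs.1 (key _ _ p (hsub v₀ hv₀ _ hev₀ he) hev)
  · intro hG
    refine SimpleGraph.Connected.mk fun u v => ?_
    classical
    -- The edges whose tail is reachable from `u`. By `hT` the head gives the same answer, so `T` is
    -- saturated and linkedness makes it everything.
    let T : Finset (Fin m) := univ.filter fun e =>
      ∃ x : {v // v ∈ G.vertices.parts}, (e, false) ∈ x.1 ∧ G.toSimpleGraph.Reachable u x
    have hT : ∀ x : {v // v ∈ G.vertices.parts}, ∀ l ∈ x.1,
        l.1 ∈ T ↔ G.toSimpleGraph.Reachable u x := by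
      rintro x ⟨e, b⟩ hl
      obtain ⟨y, hy, hey⟩ := G.vertices.exists_mem (mem_univ (e, false))
      have hxy : G.toSimpleGraph.Reachable ⟨y, hy⟩ x := by
        by_cases hxy : (⟨y, hy⟩ : {v // v ∈ G.vertices.parts}) = x
        · rw [hxy]
        · cases b with
          | false => exact absurd (Subtype.ext (G.vertices.eq_of_mem_parts hy x.2 hey hl)) hxy
          | true =>
            apply SimpleGraph.Adj.reachable
            rw [toSimpleGraph, SimpleGraph.fromRel_adj]
            exact ⟨hxy, Or.inl ⟨e, hey, hl⟩⟩
      simp only [T, mem_filter, mem_univ, true_and]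
      constructor
      · rintro ⟨z, hz, huz⟩
        have : z = ⟨y, hy⟩ := Subtype.ext (G.vertices.eq_of_mem_parts z.2 hy hz hey)
        exact (this ▸ huz).trans hxy
      · intro h
        exact ⟨⟨y, hy⟩, hey, h.trans hxy.symm⟩
    have hTu : T = univ := by
      refine hG T (subset_univ _) ?_ fun B hB => ?_
      · obtain ⟨l, hl⟩ := G.vertices.nonempty_of_mem_parts u.2
        exact ⟨l.1, (hT u l hl).2 (SimpleGraph.Reachable.refl u)⟩
      · by_cases h : G.toSimpleGraph.Reachable u ⟨B, hB⟩
        · exact Or.inl fun l hl => mem_legs.2 ((hT ⟨B, hB⟩ l hl).2 h)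
        · exact Or.inr (disjoint_left.2 fun l hl hl' => h ((hT ⟨B, hB⟩ l hl).1 (mem_legs.1 hl')))
    obtain ⟨l, hl⟩ := G.vertices.nonempty_of_mem_parts v.2
    exact (hT v l hl).1 (hTu ▸ mem_univ _)

end QGraph

/-! ### Sums of graph values as weighted partition sums. -/

section Vertices

variable {d : ℕ} (a : EuclideanSpace ℝ (Fin d)) (z : ℝ) (r : Measure (EuclideanSpace ℝ (Fin d)))
  (t : ℝ) (φ : EuclideanSpace ℝ (Fin d))

/-- The weight of a vertex, summed over the two types of vertices. -/
noncomputable def vertexWeight {E : Type} [DecidableEq E] (X : E → Fin d)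
    (v : Finset (E × Bool)) : ℝ :=
  (if v.card = 1 then ∏ l ∈ v, -φ (X l.1) else 0) +
    t * coeff a z r (fun k : Fin v.card => X (v.equivFin.symm k).1.1)

theorem legs_univ {m : ℕ} : legs (univ : Finset (Fin m)) = univ := by
  ext; simp

theorem sum_value (m : ℕ) : ∑ G : QGraph m, G.value a z r t φ =
    graphSum (vertexWeight a z r t φ) m := by
  unfold QGraph.value graphSum
  rw [sum_comm]
  refine sum_congr rfl fun X _ => ?_
  have := QGraph.sum_eq_sum_vertices (m := m) (fun _ => True) (fun _ => True) (fun _ => Iff.rfl)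
    fun P O => (∏ v ∈ O, ∏ l ∈ v, -φ (X l.1)) * ∏ v ∈ P.parts \ O,
      t * coeff a z r (fun k : Fin v.card => X (v.equivFin.symm k).1.1)
  simp only [QGraph.sum_outer, filter_true] at this
  rw [legs_univ]
  exact this

open Classical in
theorem sum_value_connected {m : ℕ} (hm : 0 < m) :
    ∑ G : QGraph m with G.IsConnected, G.value a z r t φ =
      linkedGraphSum (vertexWeight a z r t φ) m := by
  unfold QGraph.value linkedGraphSum
  rw [sum_comm]
  refine sum_congr rfl fun X _ => ?_
  have := QGraph.sum_eq_sum_vertices (m := m) (fun G => G.IsConnected)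
    (fun P => Linked univ P.parts) (QGraph.isConnected_iff_linked hm)
    fun P O => (∏ v ∈ O, ∏ l ∈ v, -φ (X l.1)) * ∏ v ∈ P.parts \ O,
      t * coeff a z r (fun k : Fin v.card => X (v.equivFin.symm k).1.1)
  simp only [QGraph.sum_outer] at this
  rw [linkedSum, legs_univ]
  exact this

end Vertices

/-! ### Derivatives at the origin indexed by finite sets of directions. -/

section LegDerivative

variable {ι V : Type*} [DecidableEq ι] [NormedAddCommGroup V] [NormedSpace ℝ V]

/-- The iterated derivative of `h` at the origin in the directions `v i`, `i ∈ S`. -/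
noncomputable def legDeriv (v : ι → V) (S : Finset ι) (h : V → ℂ) : ℂ :=
  iteratedFDeriv ℝ S.card h 0 fun k => v (S.equivFin.symm k)

/-- The derivative in the direction `v`. -/
noncomputable def dirDeriv (v : V) (h : V → ℂ) : V → ℂ := fun y => fderiv ℝ h y v

theorem analyticAt_dirDeriv {h : V → ℂ} (hh : AnalyticAt ℝ h 0) (v : V) :
    AnalyticAt ℝ (dirDeriv v h) 0 :=
  ((ContinuousLinearMap.apply ℝ ℂ v).analyticAt _).comp hh.fderiv

theorem iteratedFDeriv_dirDeriv {h : V → ℂ} (hh : AnalyticAt ℝ h 0) (u : V) {n : ℕ}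
    (m : Fin n → V) : iteratedFDeriv ℝ n (dirDeriv u h) 0 m =
      iteratedFDeriv ℝ n (fun y => fderiv ℝ h y) 0 m u := by
  have h1 : dirDeriv u h = (ContinuousLinearMap.apply ℝ ℂ u) ∘ fun y => fderiv ℝ h y := rfl
  rw [h1, ContinuousLinearMap.iteratedFDeriv_comp_left _
    ((hh.fderiv.contDiffAt (n := ω)).of_le le_top) (le_refl _)]
  rfl

variable {v : ι → V} {h f g : V → ℂ}

-- Iterated derivatives are symmetric at a point of analyticity, so the arbitrary enumeration
-- `equivFin` in the definition of `legDeriv` is immaterial.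
omit [DecidableEq ι] in
theorem legDeriv_eq_of_map (hh : AnalyticAt ℝ h 0) {n : ℕ} (e : Fin n ↪ ι) {S : Finset ι}
    (he : univ.map e = S) : iteratedFDeriv ℝ n h 0 (v ∘ e) = legDeriv v S h := by
  subst he
  have hc : n = (univ.map e).card := by simp
  let e' : Fin n ≃ (univ.map e : Finset ι) := Equiv.ofBijective
    (fun k => ⟨e k, mem_map_of_mem e (mem_univ k)⟩) (by
      constructor
      · intro a b hab
        exact e.injective (congrArg Subtype.val hab)
      · rintro ⟨x, hx⟩
        obtain ⟨k, -, rfl⟩ := Finset.mem_map.1 hx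
        exact ⟨k, rfl⟩)
  have key : ∀ {N : ℕ} (hN : n = N) (q : Fin N ≃ (univ.map e : Finset ι)),
      iteratedFDeriv ℝ n h 0 (v ∘ e) = iteratedFDeriv ℝ N h 0 fun k => v (q k) := by
    intro N hN q
    subst hN
    rw [← (hh.contDiffAt (n := ω)).iteratedFDeriv_comp_perm (fun k => v (q k)) (e'.trans q.symm)]
    congr 1
    ext k
    simp only [Function.comp_apply, Equiv.trans_apply, Equiv.apply_symm_apply]
    rfl
  exact key hc (univ.map e).equivFin.symm

omit [DecidableEq ι] in
theorem legDeriv_map {κ : Type*} (hh : AnalyticAt ℝ h 0) (e : κ ↪ ι)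
    (S : Finset κ) : legDeriv v (S.map e) h = legDeriv (v ∘ e) S h := by
  rw [← legDeriv_eq_of_map hh
    (S.equivFin.symm.toEmbedding.trans ((Function.Embedding.subtype _).trans e))]
  · rw [legDeriv]
    rfl
  · rw [← Finset.map_map, ← Finset.map_map, map_univ_equiv]
    congr 1
    ext; simp

omit [DecidableEq ι] in
@[simp]
theorem legDeriv_empty : legDeriv v ∅ h = h 0 := by
  simp only [legDeriv, card_empty]
  exact iteratedFDeriv_zero_apply _

omit [DecidableEq ι] in
theorem legDeriv_congr (hfg : f =ᶠ[𝓝 0] g) (S : Finset ι) : legDeriv v S f = legDeriv v S g := by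
  rw [legDeriv, (Filter.EventuallyEq.iteratedFDeriv ℝ hfg _).eq_of_nhds, legDeriv]

omit [DecidableEq ι] in
theorem legDeriv_add (hf : AnalyticAt ℝ f 0) (hg : AnalyticAt ℝ g 0) (S : Finset ι) :
    legDeriv v S (f + g) = legDeriv v S f + legDeriv v S g := by
  rw [legDeriv, iteratedFDeriv_add_apply ((hf.contDiffAt (n := ω)).of_le le_top)
    ((hg.contDiffAt (n := ω)).of_le le_top)]
  rfl

omit [DecidableEq ι] in
theorem legDeriv_const_mul (hf : AnalyticAt ℝ f 0) (c : ℂ) (S : Finset ι) :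
    legDeriv v S (fun y => c * f y) = c * legDeriv v S f := by
  have := iteratedFDeriv_const_smul_apply (𝕜 := ℝ) (a := c) (x := 0) (i := S.card) (f := f)
    ((hf.contDiffAt (n := ω)).of_le le_top)
  rw [legDeriv, show (fun y => c * f y) = c • f from rfl, this]
  rfl

omit [DecidableEq ι] in
theorem legDeriv_sum {κ : Type*} (s : Finset κ) {F : κ → V → ℂ}
    (hF : ∀ i ∈ s, AnalyticAt ℝ (F i) 0) (S : Finset ι) :
    legDeriv v S (fun y => ∑ i ∈ s, F i y) = ∑ i ∈ s, legDeriv v S (F i) := by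
  classical
  induction s using Finset.induction_on with
  | empty =>
    simp only [sum_empty]
    have := legDeriv_const_mul (v := v) (analyticAt_const (𝕜 := ℝ) (v := (0 : ℂ)) (x := (0 : V))) 0 S
    simpa using this
  | insert i s hi ih =>
    simp only [sum_insert hi]
    rw [← ih fun j hj => hF j (mem_insert_of_mem hj)]
    exact legDeriv_add (hF i (mem_insert_self i s))
      (Finset.analyticAt_fun_sum s fun j hj => hF j (mem_insert_of_mem hj)) S

theorem legDeriv_insert (hh : AnalyticAt ℝ h 0) {x : ι} {S : Finset ι} (hx : x ∉ S) :
    legDeriv v (insert x S) h = legDeriv v S (dirDeriv (v x) h) := by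
  -- The new direction is put last, since the last argument of an iterated derivative belongs to the
  -- derivative taken first.
  let e : Fin (S.card + 1) ↪ ι := ⟨Fin.snoc (fun k => (S.equivFin.symm k : ι)) x, by
    rw [Fin.snoc_injective_iff]
    refine ⟨fun a b hab => S.equivFin.symm.injective (Subtype.ext hab), ?_⟩
    rintro ⟨k, hk⟩
    exact hx (hk ▸ (S.equivFin.symm k).2)⟩
  have hlast : e (Fin.last _) = x :=
    Fin.snoc_last (α := fun _ => ι) x fun k => (S.equivFin.symm k : ι)
  have hcast : ∀ k, e (Fin.castSucc k) = S.equivFin.symm k := fun k =>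
    Fin.snoc_castSucc (α := fun _ => ι) x (fun k => (S.equivFin.symm k : ι)) k
  have he : univ.map e = insert x S := by
    ext y
    simp only [Finset.mem_map, mem_univ, true_and, mem_insert]
    constructor
    · rintro ⟨k, rfl⟩
      refine Fin.lastCases ?_ (fun k => ?_) k
      · exact Or.inl hlast
      · right
        rw [hcast]
        exact (S.equivFin.symm k).2
    · rintro (rfl | hy)
      · exact ⟨Fin.last _, hlast⟩
      · refine ⟨(S.equivFin ⟨y, hy⟩).castSucc, ?_⟩
        rw [hcast, Equiv.symm_apply_apply]
  rw [← legDeriv_eq_of_map hh e he, iteratedFDeriv_succ_apply_right, legDeriv,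
    iteratedFDeriv_dirDeriv hh]
  have h1 : Fin.init (v ∘ e) = fun k => v (S.equivFin.symm k) := by
    ext1 k
    exact congrArg v (hcast k)
  have h2 : (v ∘ e) (Fin.last _) = v x := congrArg v hlast
  rw [h1, h2]

/-- Differentiability is known only near the origin, hence the germ equality; by `legDeriv_congr` it
suffices. -/
theorem dirDeriv_mul (hf : AnalyticAt ℝ f 0) (hg : AnalyticAt ℝ g 0) (u : V) :
    dirDeriv u (f * g) =ᶠ[𝓝 0] dirDeriv u f * g + f * dirDeriv u g := by
  filter_upwards [hf.eventually_analyticAt, hg.eventually_analyticAt] with y hfy hgy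
  simp only [dirDeriv, Pi.add_apply, Pi.mul_apply]
  rw [fderiv_mul hfy.differentiableAt hgy.differentiableAt]
  simp only [add_apply, smul_apply, smul_eq_mul]
  ring

/-- The Leibniz rule. -/
theorem legDeriv_mul (hf : AnalyticAt ℝ f 0) (hg : AnalyticAt ℝ g 0) (S : Finset ι) :
    legDeriv v S (f * g) = ∑ T ∈ S.powerset, legDeriv v T f * legDeriv v (S \ T) g := by
  induction S using Finset.induction_on generalizing f g with
  | empty => simp
  | insert x S hx ih =>
    have hf' := analyticAt_dirDeriv hf (v x)
    have hg' := analyticAt_dirDeriv hg (v x)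
    rw [legDeriv_insert (hf.mul hg) hx, legDeriv_congr (dirDeriv_mul hf hg (v x)),
      legDeriv_add (hf'.mul hg) (hf.mul hg'), ih hf' hg, ih hf hg', sum_powerset_insert hx, add_comm]
    congr 1
    · refine sum_congr rfl fun T hT => ?_
      have hxT : x ∉ T := fun h => hx (mem_powerset.1 hT h)
      rw [insert_sdiff_of_notMem _ hxT, legDeriv_insert hg fun h => hx (mem_sdiff.1 h).1]
    · refine sum_congr rfl fun T hT => ?_
      have hxT : x ∉ T := fun h => hx (mem_powerset.1 hT h)
      rw [legDeriv_insert hf hxT, insert_sdiff_insert, sdiff_insert_of_notMem hx]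

theorem analyticAt_exp_comp (hf : AnalyticAt ℝ f 0) : AnalyticAt ℝ (fun y => Complex.exp (f y)) 0 :=
  (analyticAt_cexp (z := f 0)).restrictScalars.comp hf

theorem dirDeriv_cexp (hf : AnalyticAt ℝ f 0) (u : V) :
    dirDeriv u (fun y => Complex.exp (f y)) =ᶠ[𝓝 0]
      dirDeriv u f * fun y => Complex.exp (f y) := by
  filter_upwards [hf.eventually_analyticAt] with y hfy
  simp only [dirDeriv, Pi.mul_apply]
  rw [(hfy.differentiableAt.hasFDerivAt.cexp).fderiv]
  simp [mul_comm]

/-- The formula of Faà di Bruno for the exponential function. -/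
theorem legDeriv_cexp (hf : AnalyticAt ℝ f 0) (h0 : f 0 = 0) (S : Finset ι) :
    legDeriv v S (fun y => Complex.exp (f y)) = partitionSum (fun B => legDeriv v B f) S := by
  -- One derivative of `exp f` is `f' exp f`; the Leibniz rule for the remaining ones is exactly the
  -- recursion for partition sums. The start value `1` comes from `f 0 = 0`.
  refine eq_partitionSum_of_recursion (Z := fun S => legDeriv v S fun y => Complex.exp (f y))
    (by simp [h0]) ?_ S
  intro x S hx
  rw [legDeriv_insert (analyticAt_exp_comp hf) hx, legDeriv_congr (dirDeriv_cexp hf (v x)),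
    legDeriv_mul (analyticAt_dirDeriv hf (v x)) (analyticAt_exp_comp hf)]
  refine sum_congr rfl fun T hT => ?_
  rw [legDeriv_insert hf fun h => hx (mem_powerset.1 hT h)]

end LegDerivative

/-! ### Powers of the Laplacian as sums over edge labels. -/

section Laplacian

variable {V : Type*} [NormedAddCommGroup V] [NormedSpace ℝ V] {ι : Type*} [Fintype ι]

/-- The sum of the second derivatives in the directions `b i`. -/
noncomputable def sumSecondDeriv (b : ι → V) (h : V → ℂ) : V → ℂ :=
  fun y => ∑ i, dirDeriv (b i) (dirDeriv (b i) h) y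

theorem analyticAt_sumSecondDeriv (b : ι → V) {h : V → ℂ} (hh : AnalyticAt ℝ h 0) :
    AnalyticAt ℝ (sumSecondDeriv b h) 0 :=
  Finset.analyticAt_fun_sum _ fun _ _ => analyticAt_dirDeriv (analyticAt_dirDeriv hh _) _

theorem univ_leg_succ (m : ℕ) : (univ : Finset (Leg (m + 1))) =
    insert (0, false) (insert (0, true)
      ((univ : Finset (Leg m)).map ((Fin.succEmb m).prodMap (Function.Embedding.refl Bool)))) := by
  ext ⟨e, c⟩
  simp only [mem_univ, mem_insert, Finset.mem_map, true_and, true_iff, Prod.exists,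
    Function.Embedding.coe_prodMap, Prod.map_apply, Prod.mk.injEq]
  refine Fin.cases ?_ (fun e => ?_) e
  · cases c <;> simp
  · right; right
    exact ⟨e, c, rfl, rfl⟩

/-- Each second derivative becomes an edge: its label is the direction, its two ends are the two
derivatives. The Laplacian applied first is edge `0`. -/
theorem iterate_sumSecondDeriv (b : ι → V) (m : ℕ) {h : V → ℂ} (hh : AnalyticAt ℝ h 0) :
    (sumSecondDeriv b)^[m] h 0 =
      ∑ X : Fin m → ι, legDeriv (fun l : Leg m => b (X l.1)) univ h := by
  induction m generalizing h with
  | zero =>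
    rw [Fintype.sum_unique, show (univ : Finset (Leg 0)) = ∅ from univ_eq_empty]
    simp
  | succ m ih =>
    rw [Function.iterate_succ_apply, ih (analyticAt_sumSecondDeriv b hh)]
    rw [← (Fin.consEquiv fun _ => ι).sum_comp, Fintype.sum_prod_type, sum_comm]
    refine sum_congr rfl fun X _ => ?_
    unfold sumSecondDeriv
    rw [legDeriv_sum _ fun i _ => analyticAt_dirDeriv (analyticAt_dirDeriv hh _) _]
    refine sum_congr rfl fun i _ => ?_
    rw [univ_leg_succ, legDeriv_insert hh (by simp),
      legDeriv_insert (analyticAt_dirDeriv hh _) (by simp),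
      legDeriv_map (analyticAt_dirDeriv (analyticAt_dirDeriv hh _) _)]
    simp [Fin.consEquiv, Function.comp_def]

end Laplacian

/-! ### The jump symbol, its derivatives and the vertex weights. -/

section Symbol

variable {d : ℕ} (a : EuclideanSpace ℝ (Fin d)) (z : ℝ) (r : Measure (EuclideanSpace ℝ (Fin d)))

section

variable [IsProbabilityMeasure r]

theorem integrable_exp_inner (ξ : EuclideanSpace ℝ (Fin d)) :
    Integrable (fun y => Complex.exp (Complex.I * (inner ℝ y ξ : ℝ))) r := by
  refine Integrable.of_bound (C := 1) (by fun_prop) (ae_of_all _ fun y => ?_)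
  rw [mul_comm, Complex.norm_exp_ofReal_mul_I]

theorem jumpSymbol_eq (ξ : EuclideanSpace ℝ (Fin d)) : jumpSymbol a z r ξ =
    Complex.I * (inner ℝ a ξ : ℝ) + (z : ℂ) * (charFun r ξ - 1) := by
  rw [jumpSymbol, integral_sub (integrable_exp_inner r ξ) (integrable_const _), charFun]
  simp [mul_comm Complex.I]

theorem continuous_jumpSymbol : Continuous (jumpSymbol a z r) := by
  rw [funext (jumpSymbol_eq a z r)]
  fun_prop

theorem jumpSymbol_zero : jumpSymbol a z r 0 = 0 := by
  rw [jumpSymbol_eq]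
  simp

theorem jumpSymbol_neg (ξ : EuclideanSpace ℝ (Fin d)) :
    jumpSymbol a z r (-ξ) = (starRingEnd ℂ) (jumpSymbol a z r ξ) := by
  rw [jumpSymbol_eq, jumpSymbol_eq, charFun_neg]
  simp

theorem re_jumpSymbol_nonpos (hz : 0 ≤ z) (ξ : EuclideanSpace ℝ (Fin d)) :
    (jumpSymbol a z r ξ).re ≤ 0 := by
  rw [jumpSymbol_eq]
  have h : (charFun r ξ).re ≤ 1 := (Complex.re_le_norm _).trans (norm_charFun_le_one ξ)
  simp only [Complex.add_re, Complex.mul_re, Complex.I_re, Complex.ofReal_re, Complex.I_im,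
    Complex.ofReal_im, Complex.sub_re, Complex.one_re]
  nlinarith

theorem analyticAt_ofReal_inner (u ξ : EuclideanSpace ℝ (Fin d)) :
    AnalyticAt ℝ (fun ξ : EuclideanSpace ℝ (Fin d) => ((inner ℝ u ξ : ℝ) : ℂ)) ξ :=
  (Complex.ofRealCLM.comp (innerSL ℝ u)).analyticAt ξ

theorem analyticAt_jumpSymbol (hr : AnalyticAt ℝ (charFun r) 0) :
    AnalyticAt ℝ (jumpSymbol a z r) 0 := by
  rw [funext (jumpSymbol_eq a z r)]
  exact (analyticAt_const.mul (analyticAt_ofReal_inner a 0)).add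
    (analyticAt_const.mul (hr.sub analyticAt_const))

/-- Differentiate `Ψ(-ξ) = conj Ψ(ξ)` at the origin; every derivative on the left produces a factor
`-1`. -/
theorem iteratedFDeriv_jumpSymbol_conj (n : ℕ)
    (m : Fin n → EuclideanSpace ℝ (Fin d)) :
    (starRingEnd ℂ) (iteratedFDeriv ℝ n (jumpSymbol a z r) 0 m) =
      (-1) ^ n * iteratedFDeriv ℝ n (jumpSymbol a z r) 0 m := by
  have h1 := (Complex.conjCLE : ℂ ≃L[ℝ] ℂ).iteratedFDeriv_comp_left (f := jumpSymbol a z r)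
    (x := 0) (i := n)
  have h2 := (ContinuousLinearEquiv.neg ℝ (M := EuclideanSpace ℝ (Fin d))
    ).iteratedFDerivWithin_comp_right (jumpSymbol a z r) (s := Set.univ) (x := 0)
    uniqueDiffOn_univ (Set.mem_univ _) n
  have hfun : (Complex.conjCLE : ℂ ≃L[ℝ] ℂ) ∘ jumpSymbol a z r =
      jumpSymbol a z r ∘ ContinuousLinearEquiv.neg ℝ (M := EuclideanSpace ℝ (Fin d)) := by
    ext ξ
    exact (jumpSymbol_neg a z r ξ).symm
  rw [Set.preimage_univ, iteratedFDerivWithin_univ, iteratedFDerivWithin_univ, ← hfun, h1] at h2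
  have h3 := congrArg (· m) h2
  have h4 := (iteratedFDeriv ℝ n (jumpSymbol a z r) 0).map_smul_univ (fun _ => (-1 : ℝ)) m
  simp only [ContinuousMultilinearMap.compContinuousLinearMap_apply] at h3
  refine h3.trans ?_
  simpa using h4

/-- The joint cumulants are real. -/
theorem ofReal_coeff {n : ℕ} (X : Fin n → Fin d) :
    ((coeff a z r X : ℝ) : ℂ) = (-Complex.I) ^ n *
      iteratedFDeriv ℝ n (jumpSymbol a z r) 0
        (fun k => EuclideanSpace.single (X k) (1 : ℝ)) := by
  rw [coeff, ← Complex.conj_eq_iff_re, map_mul, iteratedFDeriv_jumpSymbol_conj a z r, map_pow,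
    map_neg, Complex.conj_I, ← mul_assoc, ← mul_pow]
  simp

end

section LinearPart

variable {ι : Type*} [DecidableEq ι]

omit [DecidableEq ι] in
theorem legDeriv_const_of_nonempty {V : Type*} [NormedAddCommGroup V] [NormedSpace ℝ V]
    (v : ι → V) (c : ℂ) {S : Finset ι} (hS : S.Nonempty) :
    legDeriv v S (fun _ => c) = 0 := by
  rw [legDeriv, iteratedFDeriv_const_of_ne hS.card_ne_zero]
  rfl

/-- A linear function has no derivatives beyond the first, which is why outer vertices have a single
leg. -/
theorem legDeriv_inner (u : EuclideanSpace ℝ (Fin d)) (v : ι → EuclideanSpace ℝ (Fin d))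
    {S : Finset ι} (hS : S.Nonempty) :
    legDeriv v S (fun ξ => ((inner ℝ u ξ : ℝ) : ℂ)) =
      if S.card = 1 then ∏ i ∈ S, ((inner ℝ u (v i) : ℝ) : ℂ) else 0 := by
  obtain ⟨x, hx⟩ := hS
  obtain ⟨T, hxT, rfl⟩ : ∃ T, x ∉ T ∧ S = insert x T :=
    ⟨S.erase x, notMem_erase x S, (insert_erase hx).symm⟩
  have hd : dirDeriv (v x) (fun ξ => ((inner ℝ u ξ : ℝ) : ℂ)) =
      fun _ => ((inner ℝ u (v x) : ℝ) : ℂ) := by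
    ext y
    exact congrArg (· (v x)) (Complex.ofRealCLM.comp (innerSL ℝ u)).fderiv
  rw [legDeriv_insert (analyticAt_ofReal_inner u 0) hxT, hd, card_insert_of_notMem hxT]
  rcases T.eq_empty_or_nonempty with rfl | hT
  · simp
  · rw [legDeriv_const_of_nonempty v _ hT, if_neg (by simpa using hT.ne_empty)]

end LinearPart

section Weights

variable (t : ℝ) (φ : EuclideanSpace ℝ (Fin d))

theorem coeff_eq_legDeriv {E : Type*} [DecidableEq E] (X : E → Fin d) (v : Finset (E × Bool)) :
    coeff a z r (fun k : Fin v.card => X (v.equivFin.symm k).1.1) = ((-Complex.I) ^ v.card *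
      legDeriv (fun l : E × Bool => EuclideanSpace.single (X l.1) (1 : ℝ)) v
        (jumpSymbol a z r)).re := rfl

variable [IsProbabilityMeasure r]

/-- Provides the hypothesis `hw` of `graphSum_succ`; it rests on the symmetry of the cumulants. -/
theorem vertexWeight_map (hr : AnalyticAt ℝ (charFun r) 0) {E F : Type} [DecidableEq E]
    [DecidableEq F] (f : F ↪ E) (X : E → Fin d) (B : Finset (F × Bool)) :
    vertexWeight a z r t φ X (B.map (f.prodMap (Function.Embedding.refl Bool))) =
      vertexWeight a z r t φ (X ∘ f) B := by
  rw [vertexWeight, vertexWeight, coeff_eq_legDeriv, coeff_eq_legDeriv,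
    legDeriv_map (analyticAt_jumpSymbol a z r hr)]
  simp [Function.comp_def]

/-- The exponent of the integrand in the Fourier representation of the density, without the
Gaussian part. -/
noncomputable def phase (ξ : EuclideanSpace ℝ (Fin d)) : ℂ :=
  t * jumpSymbol a z r ξ + -Complex.I * (inner ℝ φ ξ : ℝ)

theorem analyticAt_phase (hr : AnalyticAt ℝ (charFun r) 0) :
    AnalyticAt ℝ (phase a z r t φ) 0 :=
  (analyticAt_const.mul (analyticAt_jumpSymbol a z r hr)).add
    (analyticAt_const.mul (analyticAt_ofReal_inner φ 0))

/-- The powers of `i` undo the factor `(-i)^n` in the cumulants, and the linear term fits in because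
`-iφ = i(-φ)`. -/
theorem legDeriv_phase (hr : AnalyticAt ℝ (charFun r) 0) {E : Type} [DecidableEq E]
    (X : E → Fin d) {B : Finset (E × Bool)} (hB : B.Nonempty) :
    legDeriv (fun l : E × Bool => EuclideanSpace.single (X l.1) (1 : ℝ)) B (phase a z r t φ) =
      Complex.I ^ B.card * (vertexWeight a z r t φ X B : ℝ) := by
  have h1 := analyticAt_jumpSymbol a z r hr
  have h2 := analyticAt_ofReal_inner φ 0
  have hadd := legDeriv_add (v := fun l : E × Bool => EuclideanSpace.single (X l.1) (1 : ℝ))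
    (analyticAt_const (v := (t : ℂ)).mul h1) (analyticAt_const (v := -Complex.I).mul h2) B
  refine hadd.trans ?_
  have e1 := legDeriv_const_mul (v := fun l : E × Bool => EuclideanSpace.single (X l.1) (1 : ℝ))
    h1 (t : ℂ) B
  have e2 := legDeriv_const_mul (v := fun l : E × Bool => EuclideanSpace.single (X l.1) (1 : ℝ))
    h2 (-Complex.I) B
  have e3 : legDeriv (fun l : E × Bool => EuclideanSpace.single (X l.1) (1 : ℝ)) B
      (jumpSymbol a z r) = Complex.I ^ B.card *
        (coeff a z r (fun k : Fin B.card => X (B.equivFin.symm k).1.1) : ℝ) := by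
    rw [ofReal_coeff a z r, ← mul_assoc, ← mul_pow]
    simp [legDeriv]
  refine (congrArg₂ (· + ·) e1 e2).trans ?_
  rw [e3, legDeriv_inner φ _ hB, vertexWeight]
  push_cast
  rw [mul_add, add_comm]
  congr 1
  · split_ifs with h
    · obtain ⟨l, rfl⟩ := card_eq_one.1 h
      simp [EuclideanSpace.inner_single_right]
    · simp
  · ring

theorem iterate_sumSecondDeriv_exp_phase (hr : AnalyticAt ℝ (charFun r) 0) (m : ℕ) :
    (sumSecondDeriv fun i : Fin d => EuclideanSpace.single i (1 : ℝ))^[m]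
      (fun ξ => Complex.exp (phase a z r t φ ξ)) 0 =
    (((-1) ^ m * graphSum (vertexWeight a z r t φ) m : ℝ) : ℂ) := by
  have h := analyticAt_phase a z r t φ hr
  have h0 : phase a z r t φ 0 = 0 := by simp [phase, jumpSymbol_zero]
  rw [iterate_sumSecondDeriv _ _ (analyticAt_exp_comp h), graphSum, mul_sum, Complex.ofReal_sum]
  refine sum_congr rfl fun X _ => ?_
  rw [legDeriv_cexp h h0, partitionSum_congr fun B _ hB => legDeriv_phase a z r t φ hr X hB,
    partitionSum_pow_card_mul, legs_univ, partitionSum, partitionSum]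
  push_cast
  congr 1
  rw [card_univ, Fintype.card_prod, Fintype.card_fin, Fintype.card_bool, mul_comm, pow_mul,
    Complex.I_sq]

end Weights

end Symbol

/-! ### Homogeneous Taylor terms and a global remainder bound. -/

section TaylorTerm

variable {V : Type*} [NormedAddCommGroup V] [NormedSpace ℝ V] {f : V → ℂ}

/-- The `k`-th derivative of `f` at the origin, as a homogeneous polynomial. -/
noncomputable def taylorTerm (k : ℕ) (f : V → ℂ) (ξ : V) : ℂ := iteratedFDeriv ℝ k f 0 fun _ => ξ

theorem taylorTerm_eq_legDeriv (hf : AnalyticAt ℝ f 0) (k : ℕ) (ξ : V) :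
    taylorTerm k f ξ = legDeriv (fun _ : Fin k => ξ) univ f := by
  rw [← legDeriv_eq_of_map hf (Function.Embedding.refl (Fin k)) (by simp)]
  rfl

theorem taylorTerm_sum {κ : Type*} (s : Finset κ) {F : κ → V → ℂ}
    (hF : ∀ i ∈ s, AnalyticAt ℝ (F i) 0) (k : ℕ) (ξ : V) :
    taylorTerm k (fun y => ∑ i ∈ s, F i y) ξ = ∑ i ∈ s, taylorTerm k (F i) ξ := by
  rw [taylorTerm_eq_legDeriv (Finset.analyticAt_fun_sum s hF), legDeriv_sum s hF]
  exact sum_congr rfl fun i hi => (taylorTerm_eq_legDeriv (hF i hi) k ξ).symm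

theorem norm_taylorTerm_le (k : ℕ) (f : V → ℂ) (ξ : V) :
    ‖taylorTerm k f ξ‖ ≤ ‖iteratedFDeriv ℝ k f 0‖ * ‖ξ‖ ^ k := by
  refine (ContinuousMultilinearMap.le_opNorm _ _).trans_eq ?_
  simp

theorem continuous_taylorTerm (k : ℕ) (f : V → ℂ) : Continuous (taylorTerm k f) :=
  (iteratedFDeriv ℝ k f 0).cont.comp (continuous_pi fun _ => continuous_id)

theorem taylorTerm_neg (k : ℕ) (f : V → ℂ) (ξ : V) :
    taylorTerm k f (-ξ) = (-1) ^ k * taylorTerm k f ξ := by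
  have := (iteratedFDeriv ℝ k f 0).map_smul_univ (fun _ => (-1 : ℝ)) fun _ => ξ
  simpa [taylorTerm] using this

theorem taylorTerm_succ (hf : AnalyticAt ℝ f 0) (k : ℕ) (ξ : V) {ι : Type*} [Fintype ι]
    (c : ι → ℝ) (b : ι → V) (hξ : ξ = ∑ i, c i • b i) :
    taylorTerm (k + 1) f ξ = ∑ i, c i • taylorTerm k (dirDeriv (b i) f) ξ := by
  simp only [taylorTerm, iteratedFDeriv_dirDeriv hf]
  rw [iteratedFDeriv_succ_apply_right]
  have h : ∀ L : V →L[ℝ] ℂ, L ξ = ∑ i, c i • L (b i) := fun L => by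
    conv_lhs => rw [hξ]
    simp [map_sum]
  exact h _

theorem hasFDerivAt_taylorTerm (k : ℕ) (f : V → ℂ) (ξ : V) :
    HasFDerivAt (taylorTerm (k + 1) f)
      (((iteratedFDeriv ℝ (k + 1) f 0).linearDeriv fun _ => ξ).comp
        (ContinuousLinearMap.pi fun _ => ContinuousLinearMap.id ℝ V)) ξ := by
  have h := ((iteratedFDeriv ℝ (k + 1) f 0).hasStrictFDerivAt fun _ => ξ).hasFDerivAt
  exact HasFDerivAt.comp (f := fun (ξ : V) (_ : Fin (k + 1)) => ξ) ξ h
    (ContinuousLinearMap.pi fun _ => ContinuousLinearMap.id ℝ V).hasFDerivAt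

/-- The product rule replaces each of the `k + 1` equal arguments by `u`; by symmetry all these
terms agree. -/
theorem fderiv_taylorTerm (hf : AnalyticAt ℝ f 0) (k : ℕ) (ξ u : V) :
    fderiv ℝ (taylorTerm (k + 1) f) ξ u = (k + 1) * taylorTerm k (dirDeriv u f) ξ := by
  rw [(hasFDerivAt_taylorTerm k f ξ).fderiv]
  simp only [ContinuousLinearMap.comp_apply, ContinuousMultilinearMap.linearDeriv_apply]
  have h : ∀ i : Fin (k + 1), iteratedFDeriv ℝ (k + 1) f 0 (Function.update (fun _ => ξ) i u) =
      taylorTerm k (dirDeriv u f) ξ := by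
    intro i
    rw [← (hf.contDiffAt (n := ω)).iteratedFDeriv_comp_perm _ (Equiv.swap i (Fin.last k)),
      iteratedFDeriv_succ_apply_right, taylorTerm, iteratedFDeriv_dirDeriv hf]
    congr 2
    · ext j
      simp only [Fin.init, Function.comp_apply]
      rw [Function.update_of_ne]
      intro hj
      rw [Equiv.swap_apply_eq_iff, Equiv.swap_apply_left] at hj
      exact (Fin.castSucc_lt_last j).ne hj
    · simp
  refine (sum_congr rfl fun i _ => h i).trans ?_
  simp

/-- Taylor's formula for a bounded function, analytic at the origin, with a global bound for the
remainder. -/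
theorem exists_taylor_bound (hf : AnalyticAt ℝ f 0) (hb : ∀ ξ, ‖f ξ‖ ≤ 1) (n : ℕ) :
    ∃ K : ℝ, ∀ ξ, ‖f ξ - ∑ k ∈ range n, (k.factorial : ℂ)⁻¹ * taylorTerm k f ξ‖ ≤ K * ‖ξ‖ ^ n := by
  obtain ⟨p, R, hp⟩ := hf
  have hpt : ∀ k ξ, (k.factorial : ℂ)⁻¹ * taylorTerm k f ξ = p k fun _ => ξ := by
    intro k ξ
    rw [taylorTerm, ← hp.factorial_smul ξ k, nsmul_eq_mul, inv_mul_cancel_left₀]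
    exact_mod_cast k.factorial_ne_zero
  obtain ⟨C, hC⟩ := (hp.hasFPowerSeriesAt.isBigO_sub_partialSum_pow n).bound
  obtain ⟨δ, hδ, hball⟩ := Metric.eventually_nhds_iff.1 hC
  -- `|C|` serves the ball of radius `δ`. Outside it `f` and all lower Taylor terms are dominated by
  -- multiples of `‖ξ‖ ^ n`, which gives the rest of the constant.
  refine ⟨|C| + ((δ ^ n)⁻¹ + ∑ k ∈ range n, ‖p k‖ * (δ ^ (n - k))⁻¹), fun ξ => ?_⟩
  simp only [hpt]
  have hS : 0 ≤ (δ ^ n)⁻¹ + ∑ k ∈ range n, ‖p k‖ * (δ ^ (n - k))⁻¹ := by positivity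
  by_cases hξ : ‖ξ‖ < δ
  · have := hball (y := ξ) (by simpa using hξ)
    simp only [zero_add, norm_pow, norm_norm, FormalMultilinearSeries.partialSum] at this
    refine this.trans ?_
    gcongr
    linarith [le_abs_self C]
  · push Not at hξ
    have hpow : ∀ k ≤ n, ‖ξ‖ ^ k ≤ (δ ^ (n - k))⁻¹ * ‖ξ‖ ^ n := by
      intro k hk
      rw [inv_mul_eq_div, le_div_iff₀ (by positivity)]
      calc ‖ξ‖ ^ k * δ ^ (n - k) ≤ ‖ξ‖ ^ k * ‖ξ‖ ^ (n - k) := by gcongr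
        _ = ‖ξ‖ ^ n := by rw [← pow_add, Nat.add_sub_cancel' hk]
    calc ‖f ξ - ∑ k ∈ range n, p k fun _ => ξ‖
        ≤ ‖f ξ‖ + ∑ k ∈ range n, ‖p k fun _ => ξ‖ :=
          (norm_sub_le _ _).trans (add_le_add le_rfl (norm_sum_le _ _))
      _ ≤ (δ ^ n)⁻¹ * ‖ξ‖ ^ n + ∑ k ∈ range n, ‖p k‖ * (δ ^ (n - k))⁻¹ * ‖ξ‖ ^ n := by
          refine add_le_add ((hb ξ).trans (by simpa using hpow 0 (Nat.zero_le n))) ?_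
          refine sum_le_sum fun k hk => ?_
          refine ((p k).le_opNorm _).trans ?_
          rw [mul_assoc]
          simp only [prod_const, card_univ, Fintype.card_fin]
          gcongr
          exact hpow k (mem_range.1 hk).le
      _ = ((δ ^ n)⁻¹ + ∑ k ∈ range n, ‖p k‖ * (δ ^ (n - k))⁻¹) * ‖ξ‖ ^ n := by
          rw [add_mul, sum_mul]
      _ ≤ _ := mul_le_mul_of_nonneg_right (le_add_of_nonneg_left (abs_nonneg C)) (by positivity)

end TaylorTerm

/-! ### Gaussian moments and the expansion of Gaussian means. -/

section Gaussian

variable {d : ℕ}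

/-- The Gaussian function `exp (-b ‖ξ‖²)`. -/
noncomputable def gaussian (b : ℝ) (ξ : EuclideanSpace ℝ (Fin d)) : ℝ := Real.exp (-b * ‖ξ‖ ^ 2)

theorem gaussian_pos (b : ℝ) (ξ : EuclideanSpace ℝ (Fin d)) : 0 < gaussian b ξ := Real.exp_pos _

theorem continuous_gaussian (b : ℝ) : Continuous (gaussian b : EuclideanSpace ℝ (Fin d) → ℝ) := by
  unfold gaussian; fun_prop

theorem integral_gaussian_eq {b : ℝ} (hb : 0 < b) :
    ∫ ξ : EuclideanSpace ℝ (Fin d), gaussian b ξ = (Real.pi / b) ^ ((d : ℝ) / 2) := by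
  simpa [gaussian] using GaussianFourier.integral_rexp_neg_mul_sq_norm (V := EuclideanSpace ℝ (Fin d)) hb

theorem integral_gaussian_pos {b : ℝ} (hb : 0 < b) :
    0 < ∫ ξ : EuclideanSpace ℝ (Fin d), gaussian b ξ := by
  rw [integral_gaussian_eq hb]
  have := Real.pi_pos
  positivity

theorem integrable_gaussian {b : ℝ} (hb : 0 < b) :
    Integrable (gaussian b : EuclideanSpace ℝ (Fin d) → ℝ) :=
  Integrable.of_integral_ne_zero (integral_gaussian_pos hb).ne'

/-- Half of the exponent absorbs the power, by `y ^ n / n! ≤ exp y` with `y = b ‖ξ‖² / 2`. -/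
theorem gaussian_mul_pow_le {b : ℝ} (hb : 0 < b) (n : ℕ) (ξ : EuclideanSpace ℝ (Fin d)) :
    gaussian b ξ * ‖ξ‖ ^ (2 * n) ≤ n.factorial * (2 / b) ^ n * gaussian (b / 2) ξ := by
  have h := Real.pow_div_factorial_le_exp (b / 2 * ‖ξ‖ ^ 2) (by positivity) n
  rw [div_le_iff₀ (by positivity), mul_pow, ← pow_mul] at h
  have hg : gaussian b ξ = gaussian (b / 2) ξ * Real.exp (-(b / 2 * ‖ξ‖ ^ 2)) := by
    rw [gaussian, gaussian, ← Real.exp_add]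
    congr 1; ring
  rw [hg]
  have hb2 : (2 / b) ^ n * (b / 2) ^ n = 1 := by
    rw [← mul_pow]
    have : 2 / b * (b / 2) = 1 := by field_simp
    rw [this, one_pow]
  calc gaussian (b / 2) ξ * Real.exp (-(b / 2 * ‖ξ‖ ^ 2)) * ‖ξ‖ ^ (2 * n)
      = gaussian (b / 2) ξ * Real.exp (-(b / 2 * ‖ξ‖ ^ 2)) * (2 / b) ^ n *
        ((b / 2) ^ n * ‖ξ‖ ^ (2 * n)) := by
          linear_combination
            -(gaussian (b / 2) ξ * Real.exp (-(b / 2 * ‖ξ‖ ^ 2)) * ‖ξ‖ ^ (2 * n)) * hb2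
    _ ≤ gaussian (b / 2) ξ * Real.exp (-(b / 2 * ‖ξ‖ ^ 2)) * (2 / b) ^ n *
        (Real.exp (b / 2 * ‖ξ‖ ^ 2) * n.factorial) := by
          have := gaussian_pos (b / 2) ξ
          gcongr
    _ = n.factorial * (2 / b) ^ n * gaussian (b / 2) ξ *
        (Real.exp (-(b / 2 * ‖ξ‖ ^ 2)) * Real.exp (b / 2 * ‖ξ‖ ^ 2)) := by ring
    _ = _ := by rw [← Real.exp_add]; simp

theorem integrable_gaussian_mul_pow_even {b : ℝ} (hb : 0 < b) (n : ℕ) :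
    Integrable (fun ξ : EuclideanSpace ℝ (Fin d) => gaussian b ξ * ‖ξ‖ ^ (2 * n)) := by
  refine ((integrable_gaussian (half_pos hb)).const_mul (n.factorial * (2 / b) ^ n)).mono'
    ((continuous_gaussian b).mul (by fun_prop)).aestronglyMeasurable
    (ae_of_all _ fun ξ => ?_)
  rw [Real.norm_of_nonneg (mul_nonneg (gaussian_pos b ξ).le (by positivity))]
  exact gaussian_mul_pow_le hb n ξ

theorem integral_gaussian_mul_pow_le {b : ℝ} (hb : 0 < b) (n : ℕ) :
    ∫ ξ : EuclideanSpace ℝ (Fin d), gaussian b ξ * ‖ξ‖ ^ (2 * n) ≤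
      n.factorial * 2 ^ n * 2 ^ ((d : ℝ) / 2) * (b⁻¹) ^ n *
        ∫ ξ : EuclideanSpace ℝ (Fin d), gaussian b ξ := by
  refine (integral_mono (integrable_gaussian_mul_pow_even hb n)
    ((integrable_gaussian (half_pos hb)).const_mul _) (gaussian_mul_pow_le hb n)).trans_eq ?_
  rw [integral_const_mul, integral_gaussian_eq hb, integral_gaussian_eq (half_pos hb),
    show Real.pi / (b / 2) = 2 * (Real.pi / b) by field_simp,
    Real.mul_rpow (by norm_num) (div_nonneg Real.pi_pos.le hb.le), div_pow, inv_pow]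
  field_simp

theorem integrable_gaussian_mul_pow {b : ℝ} (hb : 0 < b) (n : ℕ) :
    Integrable (fun ξ : EuclideanSpace ℝ (Fin d) => gaussian b ξ * ‖ξ‖ ^ n) := by
  refine ((integrable_gaussian hb).add (integrable_gaussian_mul_pow_even hb n)).mono'
    ((continuous_gaussian b).mul (by fun_prop)).aestronglyMeasurable
    (ae_of_all _ fun ξ => ?_)
  rw [Real.norm_of_nonneg (mul_nonneg (gaussian_pos b ξ).le (by positivity))]
  have h1 : ‖ξ‖ ^ n ≤ 1 + ‖ξ‖ ^ (2 * n) := by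
    rw [mul_comm, pow_mul]
    nlinarith [sq_nonneg (‖ξ‖ ^ n - 1)]
  have := mul_le_mul_of_nonneg_left h1 (gaussian_pos b ξ).le
  simpa [mul_add] using this

theorem integrable_gaussian_smul {b : ℝ} (hb : 0 < b) {F : EuclideanSpace ℝ (Fin d) → ℂ}
    (hF : Continuous F) {C : ℝ} {n : ℕ} (hC : ∀ ξ, ‖F ξ‖ ≤ C * ‖ξ‖ ^ n) :
    Integrable fun ξ => gaussian b ξ • F ξ := by
  refine ((integrable_gaussian_mul_pow hb n).const_mul C).mono'
    ((continuous_gaussian b).smul hF).aestronglyMeasurable (ae_of_all _ fun ξ => ?_)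
  rw [norm_smul, Real.norm_of_nonneg (gaussian_pos b ξ).le]
  calc gaussian b ξ * ‖F ξ‖ ≤ gaussian b ξ * (C * ‖ξ‖ ^ n) := by
        have := (gaussian_pos b ξ).le
        gcongr
        exact hC ξ
    _ = _ := by ring

theorem integrable_gaussian_smul_taylorTerm {b : ℝ} (hb : 0 < b) (k : ℕ)
    (f : EuclideanSpace ℝ (Fin d) → ℂ) : Integrable fun ξ => gaussian b ξ • taylorTerm k f ξ :=
  integrable_gaussian_smul hb (continuous_taylorTerm k f) (norm_taylorTerm_le k f)

theorem hasFDerivAt_gaussian (b : ℝ) (ξ : EuclideanSpace ℝ (Fin d)) :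
    HasFDerivAt (gaussian b) ((-2 * b * gaussian b ξ) • innerSL ℝ ξ) ξ := by
  have h := (((hasStrictFDerivAt_norm_sq ξ).hasFDerivAt.const_mul (-b))).exp
  refine h.congr_fderiv ?_
  ext u
  simp [gaussian]
  ring

theorem fderiv_gaussian_single (b : ℝ) (ξ : EuclideanSpace ℝ (Fin d)) (i : Fin d) :
    fderiv ℝ (gaussian b) ξ (EuclideanSpace.single i 1) = -2 * b * (ξ i * gaussian b ξ) := by
  rw [(hasFDerivAt_gaussian b ξ).fderiv]
  simp [EuclideanSpace.inner_single_right]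
  ring

variable {f : EuclideanSpace ℝ (Fin d) → ℂ}

theorem integrable_gaussian_smul_coord_smul_taylorTerm {b : ℝ} (hb : 0 < b) (k : ℕ)
    (f : EuclideanSpace ℝ (Fin d) → ℂ) (i : Fin d) :
    Integrable fun ξ => gaussian b ξ • (ξ i • taylorTerm k f ξ) := by
  refine integrable_gaussian_smul hb
    (Continuous.smul (f := fun ξ : EuclideanSpace ℝ (Fin d) => ξ i) (by fun_prop)
      (continuous_taylorTerm k f)) (C := ‖iteratedFDeriv ℝ k f 0‖)
    (n := k + 1) fun ξ => ?_
  rw [norm_smul, pow_succ, mul_comm, ← mul_assoc]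
  exact mul_le_mul (norm_taylorTerm_le k f ξ) (PiLp.norm_apply_le ξ i) (norm_nonneg _)
    (by positivity)

/-- Gaussian integration by parts. -/
theorem integral_gaussian_coord_taylorTerm {b : ℝ} (hb : 0 < b) (hf : AnalyticAt ℝ f 0) (k : ℕ)
    (i : Fin d) : ∫ ξ, gaussian b ξ • (ξ i • taylorTerm (k + 1) f ξ) =
      ((k + 1) / (2 * b) : ℝ) •
        ∫ ξ, gaussian b ξ • taylorTerm k (dirDeriv (EuclideanSpace.single i 1) f) ξ := by
  have hp : ∀ ξ : EuclideanSpace ℝ (Fin d),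
      fderiv ℝ (gaussian b) ξ (EuclideanSpace.single i 1) • taylorTerm (k + 1) f ξ =
        (-2 * b) • (gaussian b ξ • (ξ i • taylorTerm (k + 1) f ξ)) := by
    intro ξ
    rw [fderiv_gaussian_single, smul_smul, smul_smul]
    congr 1; ring
  have hq : ∀ ξ : EuclideanSpace ℝ (Fin d),
      gaussian b ξ • fderiv ℝ (taylorTerm (k + 1) f) ξ (EuclideanSpace.single i 1) =
        ((k + 1 : ℝ)) •
          (gaussian b ξ • taylorTerm k (dirDeriv (EuclideanSpace.single i 1) f) ξ) := by
    intro ξ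
    rw [fderiv_taylorTerm hf, smul_comm (k + 1 : ℝ), Complex.real_smul (x := (k + 1 : ℝ))]
    push_cast
    rfl
  have h := integral_smul_fderiv_eq_neg_fderiv_smul_of_integrable (μ := volume)
    (f := (gaussian b : EuclideanSpace ℝ (Fin d) → ℝ)) (g := taylorTerm (k + 1) f)
    (v := EuclideanSpace.single i 1)
    (by
      simp only [hp]
      exact (integrable_gaussian_smul_coord_smul_taylorTerm hb (k + 1) f i).smul (-2 * b))
    (by
      simp only [hq]
      exact (integrable_gaussian_smul_taylorTerm hb k _).smul (k + 1 : ℝ))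
    (integrable_gaussian_smul_taylorTerm hb (k + 1) f)
    (fun ξ _ => (hasFDerivAt_gaussian b ξ).differentiableAt)
    (fun ξ _ => (hasFDerivAt_taylorTerm k f ξ).differentiableAt)
  simp only [hp, hq] at h
  rw [integral_smul, integral_smul, ← neg_smul] at h
  rw [show ((k + 1) / (2 * b) : ℝ) = (2 * b)⁻¹ * (k + 1) by ring, mul_smul, h, smul_smul]
  rw [show (2 * b)⁻¹ * -(-2 * b) = 1 by field_simp, one_smul]

/-- Expanding one argument in coordinates gives `∑ ξ i` times a Taylor term of `∂ᵢ f`; integration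
by parts trades `ξ i` for a second `∂ᵢ`. -/
theorem integral_gaussian_taylorTerm_add_two {b : ℝ} (hb : 0 < b) (hf : AnalyticAt ℝ f 0)
    (k : ℕ) : ∫ ξ, gaussian b ξ • taylorTerm (k + 2) f ξ = ((k + 1) / (2 * b) : ℝ) •
      ∫ ξ, gaussian b ξ •
        taylorTerm k (sumSecondDeriv (fun i : Fin d => EuclideanSpace.single i (1 : ℝ)) f) ξ := by
  have h1 : ∀ ξ, gaussian b ξ • taylorTerm (k + 2) f ξ =
      ∑ i, gaussian b ξ • (ξ i • taylorTerm (k + 1)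
        (dirDeriv (EuclideanSpace.single i (1 : ℝ)) f) ξ) := by
    intro ξ
    rw [taylorTerm_succ hf (k + 1) ξ (fun i => ξ i) (fun i => EuclideanSpace.single i (1 : ℝ)),
      smul_sum]
    have := (EuclideanSpace.basisFun (Fin d) ℝ).sum_repr ξ
    simpa using this.symm
  have h2 : ∀ ξ, gaussian b ξ •
      taylorTerm k (sumSecondDeriv (fun i : Fin d => EuclideanSpace.single i (1 : ℝ)) f) ξ =
      ∑ i, gaussian b ξ • taylorTerm k (dirDeriv (EuclideanSpace.single i (1 : ℝ))
        (dirDeriv (EuclideanSpace.single i (1 : ℝ)) f)) ξ := by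
    intro ξ
    rw [← smul_sum, ← taylorTerm_sum univ
      fun i _ => analyticAt_dirDeriv (analyticAt_dirDeriv hf _) _]
    rfl
  simp only [h1, h2]
  rw [integral_finsetSum _ fun i _ => integrable_gaussian_smul_coord_smul_taylorTerm hb _ _ i,
    integral_finsetSum _ fun i _ => integrable_gaussian_smul_taylorTerm hb _ _, smul_sum]
  exact sum_congr rfl fun i _ =>
    integral_gaussian_coord_taylorTerm hb (analyticAt_dirDeriv hf _) k i

theorem integral_gaussian_taylorTerm_odd (b : ℝ) (f : EuclideanSpace ℝ (Fin d) → ℂ) (m : ℕ) :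
    ∫ ξ, gaussian b ξ • taylorTerm (2 * m + 1) f ξ = 0 := by
  have h := integral_neg_eq_self (fun ξ => gaussian b ξ • taylorTerm (2 * m + 1) f ξ) volume
  have hodd : ∀ ξ, gaussian b (-ξ) • taylorTerm (2 * m + 1) f (-ξ) =
      -(gaussian b ξ • taylorTerm (2 * m + 1) f ξ) := fun ξ => by
    rw [taylorTerm_neg, pow_succ, pow_mul]
    simp [gaussian]
  simp only [hodd] at h
  rw [integral_neg] at h
  exact self_eq_neg.1 h.symm

/-- The factors `(2j + 1) / (2b)`, `j < m`, from the successive reductions multiply to `(2m)! / (m!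
(4b)^m)`. -/
theorem integral_gaussian_taylorTerm_even {b : ℝ} (hb : 0 < b) (hf : AnalyticAt ℝ f 0) (m : ℕ) :
    ∫ ξ, gaussian b ξ • taylorTerm (2 * m) f ξ =
      (((2 * m).factorial : ℂ) / (m.factorial * (4 * b) ^ m)) *
        ((sumSecondDeriv (fun i : Fin d => EuclideanSpace.single i (1 : ℝ)))^[m] f 0 *
          (∫ ξ : EuclideanSpace ℝ (Fin d), gaussian b ξ : ℝ)) := by
  induction m generalizing f with
  | zero =>
    have : ∀ ξ, taylorTerm (2 * 0) f ξ = f 0 := fun ξ => iteratedFDeriv_zero_apply _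
    simp only [this]
    rw [integral_smul_const, Complex.real_smul]
    simp [mul_comm]
  | succ m ih =>
    rw [show 2 * (m + 1) = 2 * m + 2 by ring, integral_gaussian_taylorTerm_add_two hb hf,
      ih (analyticAt_sumSecondDeriv _ hf), Function.iterate_succ_apply, Complex.real_smul,
      ← mul_assoc]
    congr 1
    have hb' : (b : ℂ) ≠ 0 := by exact_mod_cast hb.ne'
    have hm : ((m.factorial : ℕ) : ℂ) ≠ 0 := by exact_mod_cast m.factorial_ne_zero
    have hm1 : (m : ℂ) + 1 ≠ 0 := by exact_mod_cast m.succ_ne_zero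
    rw [Nat.factorial_succ (2 * m + 1), Nat.factorial_succ (2 * m), Nat.factorial_succ m, pow_succ]
    push_cast
    field_simp
    ring

theorem sum_range_even_odd {M : Type*} [AddCommMonoid M] (F : ℕ → M) (n : ℕ) :
    ∑ k ∈ range (2 * n), F k = ∑ m ∈ range n, (F (2 * m) + F (2 * m + 1)) := by
  induction n with
  | zero => simp
  | succ n ih =>
    rw [show 2 * (n + 1) = 2 * n + 1 + 1 by ring, sum_range_succ, sum_range_succ, ih,
      sum_range_succ, add_assoc]

/-- The asymptotic expansion of the Gaussian mean of a function as the Gaussian concentrates at the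
origin. -/
theorem exists_gaussian_expansion (hf : AnalyticAt ℝ f 0) (hc : Continuous f)
    (hb : ∀ ξ, ‖f ξ‖ ≤ 1) (N : ℕ) : ∃ K : ℝ, ∀ b : ℝ, 0 < b →
      ‖((∫ ξ : EuclideanSpace ℝ (Fin d), gaussian b ξ : ℝ) : ℂ)⁻¹ * (∫ ξ, gaussian b ξ • f ξ) -
        ∑ m ∈ range N, ((4 * b : ℂ)⁻¹) ^ m * ((m.factorial : ℂ)⁻¹ *
          (sumSecondDeriv (fun i : Fin d => EuclideanSpace.single i (1 : ℝ)))^[m] f 0)‖ ≤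
      K * (b⁻¹) ^ N := by
  -- Order `2N` yields `N` terms, since odd Taylor terms integrate to zero, and the mean of `‖ξ‖ ^
  -- (2N)` is of order `b⁻¹ ^ N`.
  obtain ⟨K, hK⟩ := exists_taylor_bound hf hb (2 * N)
  refine ⟨|K| * (N.factorial * 2 ^ N * 2 ^ ((d : ℝ) / 2)), fun b hb0 => ?_⟩
  set W : ℝ := ∫ ξ : EuclideanSpace ℝ (Fin d), gaussian b ξ with hW
  have hW0 : 0 < W := integral_gaussian_pos hb0
  have hWc : (W : ℂ) ≠ 0 := by exact_mod_cast hW0.ne'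
  have hint : Integrable fun ξ => gaussian b ξ • f ξ :=
    integrable_gaussian_smul hb0 hc (n := 0) (C := 1) (by simpa using hb)
  have hterm : ∀ k, Integrable fun ξ : EuclideanSpace ℝ (Fin d) =>
      gaussian b ξ • ((k.factorial : ℂ)⁻¹ * taylorTerm k f ξ) := fun k => by
    simpa [mul_left_comm] using
      (integrable_gaussian_smul_taylorTerm hb0 k f).const_mul (k.factorial : ℂ)⁻¹
  have hmain : ∫ ξ, gaussian b ξ • ∑ k ∈ range (2 * N), (k.factorial : ℂ)⁻¹ * taylorTerm k f ξ =
      W * ∑ m ∈ range N, ((4 * b : ℂ)⁻¹) ^ m * ((m.factorial : ℂ)⁻¹ *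
        (sumSecondDeriv (fun i : Fin d => EuclideanSpace.single i (1 : ℝ)))^[m] f 0) := by
    simp only [smul_sum]
    rw [integral_finsetSum _ fun k _ => hterm k, sum_range_even_odd, mul_sum]
    refine sum_congr rfl fun m _ => ?_
    have hh : ∀ k, ∫ ξ, gaussian b ξ • ((k.factorial : ℂ)⁻¹ * taylorTerm k f ξ) =
        (k.factorial : ℂ)⁻¹ * ∫ ξ, gaussian b ξ • taylorTerm k f ξ := fun k => by
      rw [← integral_const_mul]
      simp [mul_left_comm]
    rw [hh, hh, integral_gaussian_taylorTerm_odd, mul_zero, add_zero,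
      integral_gaussian_taylorTerm_even hb0 hf, ← hW]
    have hm : (((2 * m).factorial : ℕ) : ℂ) ≠ 0 := by exact_mod_cast (2 * m).factorial_ne_zero
    rw [inv_pow]
    field_simp
  have hdiff : ‖(∫ ξ, gaussian b ξ • f ξ) -
      ∫ ξ, gaussian b ξ • ∑ k ∈ range (2 * N), (k.factorial : ℂ)⁻¹ * taylorTerm k f ξ‖ ≤
      |K| * ((N.factorial * 2 ^ N * 2 ^ ((d : ℝ) / 2)) * (b⁻¹) ^ N * W) := by
    rw [← integral_sub hint (by
      simp only [smul_sum]
      exact integrable_finsetSum _ fun k _ => hterm k)]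
    refine (norm_integral_le_of_norm_le
      ((integrable_gaussian_mul_pow_even hb0 N).const_mul |K|) (ae_of_all _ fun ξ => ?_)).trans ?_
    · rw [← smul_sub, norm_smul, Real.norm_of_nonneg (gaussian_pos b ξ).le]
      calc _ ≤ gaussian b ξ * (|K| * ‖ξ‖ ^ (2 * N)) := by
            have := (gaussian_pos b ξ).le
            gcongr
            refine (hK ξ).trans ?_
            gcongr
            exact le_abs_self K
        _ = _ := by ring
    · rw [integral_const_mul]
      gcongr
      exact integral_gaussian_mul_pow_le hb0 N
  rw [hmain] at hdiff
  rw [show ∀ x y : ℂ, (W : ℂ)⁻¹ * x - y = (W : ℂ)⁻¹ * (x - W * y) from fun x y => by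
    field_simp, norm_mul, norm_inv, Complex.norm_real, Real.norm_of_nonneg hW0.le,
    inv_mul_le_iff₀ hW0]
  refine hdiff.trans_eq ?_
  ring

end Gaussian

/-! ### The Fourier transform of the density and Fourier inversion. -/

section FourierSide

variable {d : ℕ} (μ : ℝ) (a : EuclideanSpace ℝ (Fin d)) (z : ℝ)
  (r : Measure (EuclideanSpace ℝ (Fin d)))

theorem integral_mul_fourier_eq {f g : EuclideanSpace ℝ (Fin d) → ℂ} (hf : Integrable f)
    (hg : Integrable g) : ∫ x, f x * 𝓕 g x = ∫ v, 𝓕 f v * g v := by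
  simpa using! (VectorFourier.integral_fourierIntegral_smul_eq_flip
    (L := innerₗ (EuclideanSpace ℝ (Fin d))) Real.continuous_fourierChar continuous_inner
    hf hg).symm

theorem norm_fourier_le {f : EuclideanSpace ℝ (Fin d) → ℂ} (v : EuclideanSpace ℝ (Fin d)) :
    ‖𝓕 f v‖ ≤ ∫ x, ‖f x‖ :=
  VectorFourier.norm_fourierIntegral_le_integral_norm _ _ _ _ _

theorem continuous_fourier {f : EuclideanSpace ℝ (Fin d) → ℂ} (hf : Integrable f) :
    Continuous (𝓕 f) :=
  VectorFourier.fourierIntegral_continuous Real.continuous_fourierChar continuous_inner hf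

/-- The symbol of the jump-diffusion process. -/
noncomputable def levySymbol (ξ : EuclideanSpace ℝ (Fin d)) : ℂ :=
  -((μ * ‖ξ‖ ^ 2 : ℝ) : ℂ) + jumpSymbol a z r ξ

variable [IsProbabilityMeasure r]

theorem continuous_levySymbol : Continuous (levySymbol μ a z r) := by
  have := continuous_jumpSymbol a z r
  unfold levySymbol
  fun_prop

/-- The jump part of the generator acts on a Fourier transform by multiplication. -/
theorem integral_fourier_add_sub (k : 𝓢(EuclideanSpace ℝ (Fin d), ℂ))
    (x : EuclideanSpace ℝ (Fin d)) :
    ∫ y, ((𝓕 k) (x + y) - (𝓕 k) x) ∂r =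
      ∫ v, Real.fourierChar (-inner ℝ v x) •
        ((charFun r ((-2 * Real.pi) • v) - 1) * k v) := by
  have hint : ∀ w : EuclideanSpace ℝ (Fin d),
      Integrable fun v => Real.fourierChar (-inner ℝ v w) • k v := fun w =>
    (Real.fourierIntegral_convergent_iff w).2 k.integrable
  have h1 : ∀ y, (𝓕 k) (x + y) - (𝓕 k) x = ∫ v, (Real.fourierChar (-inner ℝ v (x + y)) • k v -
      Real.fourierChar (-inner ℝ v x) • k v) := fun y => by
    rw [integral_sub (hint _) (hint _)]
    rfl
  simp only [h1]
  rw [integral_integral_swap]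
  · refine integral_congr_ae (ae_of_all _ fun v => ?_)
    have h2 : ∀ y, Real.fourierChar (-inner ℝ v (x + y)) • k v -
        Real.fourierChar (-inner ℝ v x) • k v =
        (Complex.exp (Complex.I * (inner ℝ y ((-2 * Real.pi) • v) : ℝ)) - 1) *
          (Real.fourierChar (-inner ℝ v x) • k v) := by
      intro y
      simp only [Circle.smul_def, Real.fourierChar_apply, smul_eq_mul]
      rw [sub_mul, one_mul, ← mul_assoc, ← Complex.exp_add, inner_add_right, inner_smul_right,
        real_inner_comm y v]
      congr 3
      push_cast
      ring
    simp only [h2]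
    rw [integral_mul_const, integral_sub (integrable_exp_inner r _) (integrable_const _), charFun]
    simp [mul_comm Complex.I, Circle.smul_def]
    ring
  · refine ((k.integrable.norm.const_mul 2).comp_snd r).mono' ?_ (ae_of_all _ fun p => ?_)
    · refine Continuous.aestronglyMeasurable ?_
      have := k.continuous
      have := Real.continuous_fourierChar
      simp only [Function.uncurry_def, Circle.smul_def]
      fun_prop
    · refine (norm_sub_le _ _).trans_eq ?_
      simp [two_mul]

/-- The result is again the transform of a Schwartz function, so a second application reaches the
Laplacian. -/
theorem fderiv_fourier_schwartz (k : 𝓢(EuclideanSpace ℝ (Fin d), ℂ))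
    (u : EuclideanSpace ℝ (Fin d)) : ∃ k' : 𝓢(EuclideanSpace ℝ (Fin d), ℂ),
      ∂_{u} (𝓕 k) = 𝓕 k' ∧ ∀ v, k' v = -(2 * Real.pi * Complex.I) * (inner ℝ v u : ℝ) * k v := by
  refine ⟨_, SchwartzMap.lineDerivOp_fourier_eq k u, fun v => ?_⟩
  have : (inner ℝ · u).HasTemperateGrowth := ((innerSL ℝ).flip u).hasTemperateGrowth
  simp [this]
  ring

/-- Plane waves are eigenfunctions of all three parts of the generator. The symbol need not be
smooth, so `𝓕` on the right is the Fourier integral of a function that may fail to be Schwartz. -/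
theorem adjointGenerator_fourier (k : 𝓢(EuclideanSpace ℝ (Fin d), ℂ))
    (x : EuclideanSpace ℝ (Fin d)) : adjointGenerator μ a z r (𝓕 k : 𝓢(_, ℂ)) x =
      𝓕 (fun v => levySymbol μ a z r ((-2 * Real.pi) • v) * k v) x := by
  have hint : ∀ f : EuclideanSpace ℝ (Fin d) → ℂ, Integrable f →
      Integrable fun v => Real.fourierChar (-inner ℝ v x) • f v := fun f hf =>
    (Real.fourierIntegral_convergent_iff x).2 hf
  choose D hD hDv using fun i : Fin d =>
    fderiv_fourier_schwartz k (EuclideanSpace.single i (1 : ℝ))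
  choose DD hDD hDDv using fun i : Fin d =>
    fderiv_fourier_schwartz (D i) (EuclideanSpace.single i (1 : ℝ))
  have hlap : Laplacian.laplacian ((𝓕 k : 𝓢(_, ℂ)) : EuclideanSpace ℝ (Fin d) → ℂ) x =
      ∑ i, ∫ v, Real.fourierChar (-inner ℝ v x) • DD i v := by
    rw [← SchwartzMap.laplacian_apply,
      SchwartzMap.laplacian_eq_sum (EuclideanSpace.basisFun (Fin d) ℝ), _root_.sum_apply]
    refine sum_congr rfl fun i _ => ?_
    rw [EuclideanSpace.basisFun_apply, hD i, hDD i]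
    rfl
  have hder : ∀ i, fderiv ℝ ((𝓕 k : 𝓢(_, ℂ)) : EuclideanSpace ℝ (Fin d) → ℂ) x
      (EuclideanSpace.single i 1) = ∫ v, Real.fourierChar (-inner ℝ v x) • D i v := fun i => by
    rw [← SchwartzMap.lineDerivOp_apply_eq_fderiv, hD i]
    rfl
  have hjump : Integrable fun v => (charFun r ((-2 * Real.pi) • v) - 1) * k v := by
    refine k.integrable.bdd_mul (c := 2)
      (Continuous.aestronglyMeasurable (by fun_prop)) (ae_of_all _ fun v => ?_)
    refine (norm_sub_le _ _).trans ?_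
    have := norm_charFun_le_one (μ := r) ((-2 * Real.pi) • v)
    rw [norm_one]
    linarith
  rw [adjointGenerator, hlap, integral_fourier_add_sub]
  simp only [hder, mul_sum]
  simp only [← integral_const_mul]
  have hA : ∀ i ∈ univ, Integrable fun v => (μ : ℂ) * Real.fourierChar (-inner ℝ v x) • DD i v :=
    fun i _ => (hint _ (DD i).integrable).const_mul _
  have hB : ∀ i ∈ univ, Integrable fun v => (a i : ℂ) * Real.fourierChar (-inner ℝ v x) • D i v :=
    fun i _ => (hint _ (D i).integrable).const_mul _
  have hAB : Integrable fun v => (∑ i, (μ : ℂ) * Real.fourierChar (-inner ℝ v x) • DD i v) +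
      ∑ i, (a i : ℂ) * Real.fourierChar (-inner ℝ v x) • D i v :=
    (integrable_finsetSum _ hA).add (integrable_finsetSum _ hB)
  rw [← integral_finsetSum _ hA, ← integral_finsetSum _ hB,
    ← integral_add (integrable_finsetSum _ hA) (integrable_finsetSum _ hB),
    ← integral_add hAB ((hint _ hjump).const_mul _), Real.fourier_eq]
  refine integral_congr_ae (ae_of_all _ fun v => ?_)
  have hn : (‖v‖ : ℂ) ^ 2 = ∑ i, (v i : ℂ) * v i := by
    have := EuclideanSpace.real_norm_sq_eq v
    rw [← Complex.ofReal_pow, this]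
    push_cast
    simp [sq]
  have hi : ((inner ℝ a v : ℝ) : ℂ) = ∑ i, (a i : ℂ) * v i := by
    rw [PiLp.inner_apply]
    push_cast
    simp [mul_comm]
  simp only [hDDv, hDv, levySymbol, jumpSymbol_eq, Circle.smul_def, smul_eq_mul,
    EuclideanSpace.inner_single_right, inner_smul_right, norm_smul]
  generalize ((Real.fourierChar (-inner ℝ v x) : Circle) : ℂ) = e
  generalize charFun r ((-2 * Real.pi) • v) = c
  have e1 : ∑ i : Fin d, (μ : ℂ) * (e * (-(2 * Real.pi * Complex.I) * ((1 * (starRingEnd ℝ) (v i) : ℝ) : ℂ) *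
      (-(2 * Real.pi * Complex.I) * ((1 * (starRingEnd ℝ) (v i) : ℝ) : ℂ) * k v))) =
      -(μ * (2 * Real.pi) ^ 2 * e * k v) * (‖v‖ : ℂ) ^ 2 := by
    rw [hn, mul_sum]
    refine sum_congr rfl fun i _ => ?_
    simp
    linear_combination (μ : ℂ) * e * 4 * Real.pi ^ 2 * v i ^ 2 * k v * Complex.I_sq
  have e2 : ∑ i : Fin d, (a i : ℂ) * (e * (-(2 * Real.pi * Complex.I) *
      ((1 * (starRingEnd ℝ) (v i) : ℝ) : ℂ) * k v)) =
      -(2 * Real.pi * Complex.I * e * k v) * ((inner ℝ a v : ℝ) : ℂ) := by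
    rw [hi, mul_sum]
    refine sum_congr rfl fun i _ => ?_
    simp
    ring
  rw [e1, e2]
  push_cast
  rw [Real.norm_eq_abs, abs_mul]
  simp [abs_of_pos Real.pi_pos]
  ring

variable {μ a z r} {Φ : ℝ → EuclideanSpace ℝ (Fin d) → ℝ}

omit [IsProbabilityMeasure r] in
theorem IsJumpDiffusionDensity.integrable_ofReal (hΦ : IsJumpDiffusionDensity μ a z r Φ) {t : ℝ}
    (ht : 0 < t) : Integrable fun x => (Φ t x : ℂ) := (hΦ.integrable t ht).ofReal

omit [IsProbabilityMeasure r] in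
theorem IsJumpDiffusionDensity.norm_fourier_le_one (hΦ : IsJumpDiffusionDensity μ a z r Φ) {t : ℝ}
    (ht : 0 < t) (v : EuclideanSpace ℝ (Fin d)) : ‖𝓕 (fun x => (Φ t x : ℂ)) v‖ ≤ 1 := by
  refine (norm_fourier_le v).trans_eq ?_
  rw [← hΦ.integral_eq_one t ht]
  refine integral_congr_ae (ae_of_all _ fun x => ?_)
  simp [abs_of_nonneg (hΦ.nonneg t ht x)]

set_option maxHeartbeats 800000 in
/-- Tested against a bump function with small support, the Fourier transform of the density
nearly solves an ordinary differential equation. -/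
theorem IsJumpDiffusionDensity.norm_exp_mul_integral_sub_one_le
    (hΦ : IsJumpDiffusionDensity μ a z r Φ) {t : ℝ} (ht : 0 < t)
    (v₀ : EuclideanSpace ℝ (Fin d)) (k : ContDiffBump v₀) {ε : ℝ}
    (hε : ∀ v ∈ Metric.ball v₀ k.rOut, ‖levySymbol μ a z r ((-2 * Real.pi) • v) -
      levySymbol μ a z r ((-2 * Real.pi) • v₀)‖ ≤ ε) :
    ‖Complex.exp (-levySymbol μ a z r ((-2 * Real.pi) • v₀) * t) *
      (∫ v, 𝓕 (fun x => (Φ t x : ℂ)) v * (k.normed volume v : ℝ)) - 1‖ ≤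
      Real.exp (‖levySymbol μ a z r ((-2 * Real.pi) • v₀)‖ * t) * ε * t := by
  set M : EuclideanSpace ℝ (Fin d) → ℂ := fun v => levySymbol μ a z r ((-2 * Real.pi) • v) with hM
  change ‖Complex.exp (-M v₀ * t) * _ - 1‖ ≤ Real.exp (‖M v₀‖ * t) * ε * t
  have hMc : Continuous M := (continuous_levySymbol μ a z r).comp (by fun_prop)
  have hkc : HasCompactSupport fun v => ((k.normed volume v : ℝ) : ℂ) :=
    k.hasCompactSupport_normed.comp_left Complex.ofReal_zero
  -- The plane wave of frequency `v₀` is not a Schwartz function; the equation is tested against `𝓕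
  -- κ`, an average of plane waves of nearby frequencies.
  let κ : 𝓢(EuclideanSpace ℝ (Fin d), ℂ) := hkc.toSchwartzMap
    (Complex.ofRealCLM.contDiff.comp k.contDiff_normed)
  have hκ : ∀ v, κ v = (k.normed volume v : ℝ) := fun v => rfl
  have hMk : Integrable fun v => M v * κ v :=
    (hMc.mul κ.continuous).integrable_of_hasCompactSupport (hkc.mul_left)
  have hu : ∀ s, 0 < s → ∫ x, (Φ s x : ℂ) * (𝓕 κ) x = ∫ v, 𝓕 (fun x => (Φ s x : ℂ)) v * κ v :=
    fun s hs => integral_mul_fourier_eq (hΦ.integrable_ofReal hs) κ.integrable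
  set u : ℝ → ℂ := fun s => ∫ x, (Φ s x : ℂ) * (𝓕 κ) x with hu_def
  have hbdd : ∀ s, 0 < s → ∀ g : EuclideanSpace ℝ (Fin d) → ℂ, Integrable g →
      Integrable fun v => 𝓕 (fun x => (Φ s x : ℂ)) v * g v := fun s hs g hg =>
    hg.bdd_mul (continuous_fourier (hΦ.integrable_ofReal hs)).aestronglyMeasurable
      (ae_of_all _ (hΦ.norm_fourier_le_one hs))
  have hu' : ∀ s : ℝ, 0 < s → HasDerivAt u (∫ v, 𝓕 (fun x => (Φ s x : ℂ)) v * (M v * κ v)) s := by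
    intro s hs
    refine (hΦ.equation (𝓕 κ) s hs).congr_deriv ?_
    simp only [adjointGenerator_fourier]
    exact integral_mul_fourier_eq (hΦ.integrable_ofReal hs) hMk
  have hclose : ∀ s : ℝ, 0 < s →
      ‖(∫ v, 𝓕 (fun x => (Φ s x : ℂ)) v * (M v * κ v)) - M v₀ * u s‖ ≤ ε := by
    intro s hs
    rw [hu_def]
    simp only
    rw [hu s hs, ← integral_const_mul, ← integral_sub (hbdd s hs _ hMk)
      ((hbdd s hs _ κ.integrable).const_mul _)]
    refine (norm_integral_le_of_norm_le (k.integrable_normed.const_mul ε)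
      (ae_of_all _ fun v => ?_)).trans_eq ?_
    · have hfac : 𝓕 (fun x => (Φ s x : ℂ)) v * (M v * κ v) -
          M v₀ * (𝓕 (fun x => (Φ s x : ℂ)) v * κ v) =
          𝓕 (fun x => (Φ s x : ℂ)) v * ((M v - M v₀) * κ v) := by ring
      rw [hfac, norm_mul, norm_mul, hκ, Complex.norm_real,
        Real.norm_of_nonneg (k.nonneg_normed v)]
      by_cases hv : v ∈ Metric.ball v₀ k.rOut
      · calc _ ≤ 1 * (ε * k.normed volume v) := by
              have := k.nonneg_normed (μ := volume) v
              have h1 := hΦ.norm_fourier_le_one hs v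
              have h2 := hε v hv
              gcongr
          _ = _ := one_mul _
      · rw [← k.support_normed_eq (μ := volume), Function.notMem_support] at hv
        simp [hv]
    · rw [integral_const_mul, k.integral_normed, mul_one]
  have hε0 : 0 ≤ ε := (norm_nonneg _).trans (hclose t ht)
  -- The integrating factor leaves only the error of size `ε` in the derivative of `y`. As the
  -- equation holds for positive times only, `y t` is compared with `y s` and then `s ↘ 0`, where `y
  -- s → (𝓕 κ) 0 = ∫ κ = 1`.
  set y : ℝ → ℂ := fun s => Complex.exp (-M v₀ * s) * u s with hy_def
  have hy' : ∀ s : ℝ, 0 < s → HasDerivAt y (Complex.exp (-M v₀ * s) *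
      ((∫ v, 𝓕 (fun x => (Φ s x : ℂ)) v * (M v * κ v)) - M v₀ * u s)) s := by
    intro s hs
    have h1 : HasDerivAt (fun s : ℝ => Complex.exp (-M v₀ * s))
        (Complex.exp (-M v₀ * s) * (-M v₀ * 1)) s :=
      ((hasDerivAt_id s).ofReal_comp.const_mul (-M v₀)).cexp
    refine (h1.mul (hu' s hs)).congr_deriv ?_
    ring
  have hbound : ∀ s ∈ Set.Ioc 0 t, ‖y t - y s‖ ≤ Real.exp (‖M v₀‖ * t) * ε * t := by
    intro s hs
    have := (convex_Icc s t).norm_image_sub_le_of_norm_hasDerivWithin_le (f := y)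
      (C := Real.exp (‖M v₀‖ * t) * ε) (x := s) (y := t)
      (fun x hx => (hy' x (hs.1.trans_le hx.1)).hasDerivWithinAt) (fun x hx => ?_)
      (Set.left_mem_Icc.2 hs.2) (Set.right_mem_Icc.2 hs.2)
    · refine this.trans ?_
      have : ‖t - s‖ ≤ t := by
        rw [Real.norm_of_nonneg (sub_nonneg.2 hs.2)]
        linarith [hs.1]
      gcongr
    · rw [norm_mul]
      refine mul_le_mul ?_ (hclose x (hs.1.trans_le hx.1)) (norm_nonneg _) (Real.exp_pos _).le
      rw [Complex.norm_exp]
      apply Real.exp_le_exp.2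
      refine (Complex.re_le_norm _).trans ?_
      rw [norm_mul, norm_neg, Complex.norm_real, Real.norm_of_nonneg (hs.1.le.trans hx.1)]
      gcongr
      exact hx.2
  have hlim : Tendsto y (𝓝[>] 0) (𝓝 1) := by
    have h1 : Tendsto (fun s : ℝ => Complex.exp (-M v₀ * s)) (𝓝[>] 0) (𝓝 1) := by
      have : Continuous fun s : ℝ => Complex.exp (-M v₀ * s) := by fun_prop
      simpa using (this.tendsto 0).mono_left nhdsWithin_le_nhds
    have h2 : (𝓕 κ) 0 = 1 := by
      change 𝓕 (κ : EuclideanSpace ℝ (Fin d) → ℂ) 0 = 1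
      rw [Real.fourier_eq]
      simp only [inner_zero_right, neg_zero, AddChar.map_zero_eq_one, one_smul, hκ]
      rw [integral_complex_ofReal, k.integral_normed, Complex.ofReal_one]
    have h3 := h1.mul (hΦ.initial (𝓕 κ))
    rw [h2, one_mul] at h3
    exact h3
  have hle := le_of_tendsto (tendsto_const_nhds.sub hlim).norm
    (show ∀ᶠ s in 𝓝[>] (0 : ℝ), ‖y t - y s‖ ≤ Real.exp (‖M v₀‖ * t) * ε * t by
      filter_upwards [Ioc_mem_nhdsGT ht] with s hs using hbound s hs)
  rw [hy_def] at hle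
  simp only [hu_def] at hle
  rw [hu t ht] at hle
  exact hle

/-- The Fourier transform of the density, by the formula of Lévy and Khinchin. -/
theorem IsJumpDiffusionDensity.fourier_eq (hΦ : IsJumpDiffusionDensity μ a z r Φ) {t : ℝ}
    (ht : 0 < t) (v₀ : EuclideanSpace ℝ (Fin d)) : 𝓕 (fun x => (Φ t x : ℂ)) v₀ =
      Complex.exp (t * levySymbol μ a z r ((-2 * Real.pi) • v₀)) := by
  set M : EuclideanSpace ℝ (Fin d) → ℂ := fun v => levySymbol μ a z r ((-2 * Real.pi) • v) with hM
  change _ = Complex.exp (t * M v₀)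
  have hMc : Continuous M := (continuous_levySymbol μ a z r).comp (by fun_prop)
  have hFc := continuous_fourier (hΦ.integrable_ofReal ht)
  set F := 𝓕 (fun x => (Φ t x : ℂ)) with hF
  set C := Real.exp (‖M v₀‖ * t) with hC
  have key : ∀ ε > 0, ‖Complex.exp (-M v₀ * t) * F v₀ - 1‖ ≤ ε * (C * t + C) := by
    intro ε hε
    obtain ⟨δ₁, hδ₁, h1⟩ := Metric.continuous_iff.1 hMc v₀ ε hε
    obtain ⟨δ₂, hδ₂, h2⟩ := Metric.continuous_iff.1 hFc v₀ ε hε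
    -- On this support both the symbol and the Fourier transform vary by at most `ε`, so the average
    -- over the bump may be replaced by the value at `v₀`.
    let k : ContDiffBump v₀ := ⟨min δ₁ δ₂ / 2, min δ₁ δ₂, by positivity,
      half_lt_self (by positivity)⟩
    have hk1 := hΦ.norm_exp_mul_integral_sub_one_le ht v₀ k (ε := ε) fun v hv => by
      rw [← dist_eq_norm]
      exact (h1 v (lt_of_lt_of_le hv (min_le_left _ _))).le
    change ‖Complex.exp (-M v₀ * t) * (∫ v, F v * (k.normed volume v : ℝ)) - 1‖ ≤ C * ε * t at hk1
    have hk2 : ‖F v₀ - ∫ v, F v * (k.normed volume v : ℝ)‖ ≤ ε := by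
      have hki : Integrable fun v => ((k.normed volume v : ℝ) : ℂ) := k.integrable_normed.ofReal
      have hFi : Integrable fun v => F v * ((k.normed volume v : ℝ) : ℂ) :=
        hki.bdd_mul hFc.aestronglyMeasurable
          (ae_of_all _ (hΦ.norm_fourier_le_one ht))
      have h0 : F v₀ = ∫ v, F v₀ * ((k.normed volume v : ℝ) : ℂ) := by
        rw [integral_const_mul, integral_complex_ofReal, k.integral_normed]
        simp
      conv_lhs => rw [h0]
      rw [← integral_sub (hki.const_mul _) hFi]
      refine (norm_integral_le_of_norm_le (k.integrable_normed.const_mul ε)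
        (ae_of_all _ fun v => ?_)).trans_eq ?_
      · rw [← sub_mul, norm_mul, Complex.norm_real, Real.norm_of_nonneg (k.nonneg_normed v)]
        by_cases hv : v ∈ Metric.ball v₀ k.rOut
        · have := k.nonneg_normed (μ := volume) v
          gcongr
          rw [← dist_eq_norm, dist_comm]
          exact (h2 v (lt_of_lt_of_le hv (min_le_right _ _))).le
        · rw [← k.support_normed_eq (μ := volume), Function.notMem_support] at hv
          simp [hv]
      · rw [integral_const_mul, k.integral_normed, mul_one]
    have hexp : ‖Complex.exp (-M v₀ * t)‖ ≤ C := by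
      rw [Complex.norm_exp, hC]
      apply Real.exp_le_exp.2
      refine (Complex.re_le_norm _).trans ?_
      rw [norm_mul, norm_neg, Complex.norm_real, Real.norm_of_nonneg ht.le]
    calc ‖Complex.exp (-M v₀ * t) * F v₀ - 1‖
        = ‖(Complex.exp (-M v₀ * t) * (∫ v, F v * (k.normed volume v : ℝ)) - 1) +
          Complex.exp (-M v₀ * t) * (F v₀ - ∫ v, F v * (k.normed volume v : ℝ))‖ := by
            congr 1; ring
      _ ≤ C * ε * t + C * ε := by
          refine (norm_add_le _ _).trans (add_le_add hk1 ?_)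
          rw [norm_mul]
          gcongr
      _ = _ := by ring
  have hC0 : 0 < C * t + C := by positivity
  have h0 : ‖Complex.exp (-M v₀ * t) * F v₀ - 1‖ ≤ 0 := by
    refine le_of_forall_pos_le_add fun η hη => ?_
    rw [zero_add]
    refine (key (η / (C * t + C)) (by positivity)).trans_eq ?_
    exact div_mul_cancel₀ _ hC0.ne'
  have h1 := sub_eq_zero.1 (norm_le_zero_iff.1 h0)
  rw [show (t : ℂ) * M v₀ = -(-M v₀ * t) by ring, Complex.exp_neg]
  exact eq_inv_of_mul_eq_one_right h1

theorem norm_exp_phase_le_one (hz : 0 ≤ z) {t : ℝ} (ht : 0 < t) (φ ξ : EuclideanSpace ℝ (Fin d)) :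
    ‖Complex.exp (phase a z r t φ ξ)‖ ≤ 1 := by
  rw [Complex.norm_exp, Real.exp_le_one_iff, phase]
  have := re_jumpSymbol_nonpos a z r hz ξ
  simp only [Complex.add_re, Complex.mul_re, Complex.ofReal_re, Complex.ofReal_im, Complex.neg_re,
    Complex.I_re, Complex.neg_im, Complex.I_im]
  nlinarith

theorem continuous_exp_phase (t : ℝ) (φ : EuclideanSpace ℝ (Fin d)) :
    Continuous fun ξ => Complex.exp (phase a z r t φ ξ) := by
  have := continuous_jumpSymbol a z r
  unfold phase
  fun_prop

/-- The density at a point as a Gaussian mean. -/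
theorem IsJumpDiffusionDensity.eq_gaussian_mean (hΦ : IsJumpDiffusionDensity μ a z r Φ)
    (hμ : 0 < μ) (hz : 0 ≤ z) {t : ℝ} (ht : 0 < t) (φ : EuclideanSpace ℝ (Fin d)) :
    (Φ t φ : ℂ) = (((2 * Real.pi) ^ d)⁻¹ : ℝ) *
      ∫ ξ, gaussian (μ * t) ξ • Complex.exp (phase a z r t φ ξ) := by
  set F : EuclideanSpace ℝ (Fin d) → ℂ :=
    fun ξ => gaussian (μ * t) ξ • Complex.exp (phase a z r t φ ξ) with hF
  have hFi : Integrable F := integrable_gaussian_smul (mul_pos hμ ht) (continuous_exp_phase t φ)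
    (n := 0) (C := 1) (by simpa using norm_exp_phase_le_one hz ht φ)
  have hpi : -2 * Real.pi ≠ 0 := by have := Real.pi_pos; simp [this.ne']
  -- The integrand of the inversion formula in the variable `ξ = -2πv`; this substitution is the
  -- source of `(2π)^(-d)`. The Gaussian in `F` also gives the integrability that inversion needs.
  have hkey : ∀ v, Real.fourierChar (inner ℝ v φ) • 𝓕 (fun x => (Φ t x : ℂ)) v =
      F ((-2 * Real.pi) • v) := by
    intro v
    rw [hΦ.fourier_eq ht, hF]
    simp only [Circle.smul_def, Real.fourierChar_apply, smul_eq_mul, gaussian, Complex.real_smul,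
      Complex.ofReal_exp]
    rw [← Complex.exp_add, ← Complex.exp_add, levySymbol, phase, inner_smul_right,
      real_inner_comm v φ]
    congr 1
    push_cast
    ring
  have hFourier : Integrable (𝓕 fun x => (Φ t x : ℂ)) := by
    have h := (hFi.comp_smul hpi)
    simp only [← hkey] at h
    have h' := (Real.fourierIntegral_convergent_iff (-φ)).1
      (by simpa [inner_neg_right] using h)
    exact h'
  have hinv := (Complex.continuous_ofReal.comp (hΦ.continuous t ht)).fourierInv_fourier_eq
    (hΦ.integrable_ofReal ht) hFourier
  have hinv' := congrFun hinv φ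
  rw [Function.comp_apply] at hinv'
  rw [← hinv', Real.fourierInv_eq]
  have hs := Measure.integral_comp_smul volume F (-2 * Real.pi)
  rw [← Complex.real_smul]
  refine Eq.trans (integral_congr_ae (ae_of_all _ hkey)) (hs.trans ?_)
  congr 1
  rw [finrank_euclideanSpace_fin, abs_inv, abs_pow, abs_mul, abs_of_pos Real.pi_pos]
  simp

end FourierSide

/-! ### Asymptotic series and their logarithms. -/

section AsymptoticSeries

open Polynomial

theorem isAsymptoticSeries_of_bound {f : ℝ → ℝ} {c : ℕ → ℝ}
    (h : ∀ N : ℕ, ∃ K : ℝ, ∀ᶠ β in 𝓝[>] (0 : ℝ),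
      |f β - ∑ m ∈ range (N + 1), β ^ m * c m| ≤ K * β ^ (N + 1)) : IsAsymptoticSeries f c := by
  intro N
  obtain ⟨K, hK⟩ := h N
  have hlim : Tendsto (fun β : ℝ => K * β) (𝓝[>] 0) (𝓝 0) := by
    have : Continuous fun β : ℝ => K * β := by fun_prop
    simpa using (this.tendsto 0).mono_left nhdsWithin_le_nhds
  refine squeeze_zero' ?_ ?_ hlim
  · filter_upwards [self_mem_nhdsWithin] with β hβ
    have : 0 < β := hβ
    positivity
  · filter_upwards [self_mem_nhdsWithin, hK] with β hβ h
    have hβ : 0 < β := hβ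
    rw [inv_mul_le_iff₀ (by positivity)]
    exact h.trans_eq (by ring)

theorem abs_log_le_two_mul {u : ℝ} (hu : 1 / 2 ≤ u) : |Real.log u| ≤ 2 * |u - 1| := by
  have h0 : 0 < u := by linarith
  have h1 := Real.log_le_sub_one_of_pos h0
  have h2 := Real.one_sub_inv_le_log_of_pos h0
  have h3 : -(2 * |u - 1|) ≤ 1 - u⁻¹ := by
    have : 1 - u⁻¹ = (u - 1) * u⁻¹ := by field_simp
    have h4 : u⁻¹ ≤ 2 := by
      rw [inv_le_comm₀ h0 (by norm_num)]
      linarith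
    have h5 : |(u - 1) * u⁻¹| ≤ |u - 1| * 2 := by
      rw [abs_mul, abs_of_pos (inv_pos.2 h0)]
      gcongr
    rw [this]
    linarith [(abs_le.1 h5).1]
  rw [abs_le]
  exact ⟨h3.trans h2, h1.trans (by linarith [le_abs_self (u - 1), abs_nonneg (u - 1)])⟩

/-- The polynomial with coefficients `c 0, …, c N`. -/
noncomputable def truncation (c : ℕ → ℝ) (N : ℕ) : ℝ[X] := ∑ m ∈ range (N + 1), monomial m (c m)

theorem coeff_truncation (c : ℕ → ℝ) (N n : ℕ) :
    (truncation c N).coeff n = if n ≤ N then c n else 0 := by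
  simp [truncation, coeff_monomial]

theorem eval_truncation (c : ℕ → ℝ) (N : ℕ) (x : ℝ) :
    (truncation c N).eval x = ∑ m ∈ range (N + 1), x ^ m * c m := by
  simp [truncation, eval_finsetSum, mul_comm]

/-- Truncations of formal power series `a` and `c` with `a = exp c`. -/
theorem exists_truncation_mul_exp_bound {a c : ℕ → ℝ} (ha : a 0 = 1) (hc : c 0 = 0)
    (hrec : ∀ n : ℕ, (n + 1) * a (n + 1) =
      ∑ k ∈ range (n + 1), (k + 1) * c (k + 1) * a (n - k)) (N : ℕ) :
    ∃ K : ℝ, ∀ x ∈ Set.Icc (0 : ℝ) 1,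
      |(truncation a N).eval x * Real.exp (-(truncation c N).eval x) - 1| ≤ K * x ^ (N + 1) := by
  set P := truncation a N with hP
  set Q := truncation c N with hQ
  -- `hrec` says `a' = c' a` for formal power series, and truncation preserves this below degree
  -- `N`. Hence `P exp (-Q)` has derivative `O(x ^ N)` and differs from its value `1` at `0` by `O(x
  -- ^ (N + 1))`.
  have hdvd : (X : ℝ[X]) ^ N ∣ derivative P - derivative Q * P := by
    rw [X_pow_dvd_iff]
    intro n hn
    rw [coeff_sub, coeff_derivative, coeff_mul, hP, coeff_truncation, if_pos (by omega),
      mul_comm, hrec, Nat.sum_antidiagonal_eq_sum_range_succ_mk, sub_eq_zero]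
    refine sum_congr rfl fun k hk => ?_
    rw [mem_range] at hk
    rw [coeff_derivative, hQ, coeff_truncation, coeff_truncation, if_pos (by omega),
      if_pos (by omega)]
    ring
  obtain ⟨R, hR⟩ := hdvd
  have hder : ∀ x, HasDerivAt (fun x => P.eval x * Real.exp (-Q.eval x))
      (x ^ N * (R.eval x * Real.exp (-Q.eval x))) x := by
    intro x
    refine ((P.hasDerivAt x).mul ((Q.hasDerivAt x).neg.exp)).congr_deriv ?_
    have := congrArg (eval x) hR
    simp only [eval_sub, eval_mul, eval_pow, eval_X] at this
    simp only [Pi.neg_apply]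
    linear_combination Real.exp (-Q.eval x) * this
  have hcont : Continuous fun x => R.eval x * Real.exp (-Q.eval x) := by
    have := R.continuous
    have := Q.continuous
    fun_prop
  obtain ⟨K, hK⟩ := isCompact_Icc.exists_bound_of_continuousOn
    (s := Set.Icc (0 : ℝ) 1) hcont.continuousOn
  refine ⟨K, fun x hx => ?_⟩
  have hmv := (convex_Icc 0 x).norm_image_sub_le_of_norm_hasDerivWithin_le
    (f := fun x => P.eval x * Real.exp (-Q.eval x)) (C := x ^ N * K) (x := 0) (y := x)
    (fun y _ => (hder y).hasDerivWithinAt) (fun y hy => ?_)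
    (Set.left_mem_Icc.2 hx.1) (Set.right_mem_Icc.2 hx.1)
  · have h0 : P.eval 0 * Real.exp (-Q.eval 0) = 1 := by
      rw [← coeff_zero_eq_eval_zero, ← coeff_zero_eq_eval_zero, hP, hQ, coeff_truncation,
        coeff_truncation]
      simp [ha, hc]
    simp only [h0, sub_zero, Real.norm_eq_abs, abs_of_nonneg hx.1] at hmv
    exact hmv.trans_eq (by ring)
  · rw [norm_mul, norm_pow, Real.norm_of_nonneg hy.1]
    have h1 := hK y ⟨hy.1, hy.2.trans hx.2⟩
    have h2 := hx.1
    have h3 := hy.1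
    have h4 := hy.2
    gcongr

/-- The logarithm of an asymptotic series. -/
theorem isAsymptoticSeries_log {f : ℝ → ℝ} {a c : ℕ → ℝ} (ha : a 0 = 1) (hc : c 0 = 0)
    (hrec : ∀ n : ℕ, (n + 1) * a (n + 1) =
      ∑ k ∈ range (n + 1), (k + 1) * c (k + 1) * a (n - k))
    (h : ∀ N : ℕ, ∃ K : ℝ, ∀ᶠ β in 𝓝[>] (0 : ℝ),
      |f β - ∑ m ∈ range (N + 1), β ^ m * a m| ≤ K * β ^ (N + 1)) :
    IsAsymptoticSeries (fun β => Real.log (f β)) c := by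
  refine isAsymptoticSeries_of_bound fun N => ?_
  obtain ⟨K, hK⟩ := h N
  obtain ⟨K', hK'⟩ := exists_truncation_mul_exp_bound ha hc hrec N
  simp only [← eval_truncation] at hK ⊢
  set P := truncation a N
  set Q := truncation c N
  have hcont : Continuous fun x => Real.exp (-Q.eval x) := by
    have := Q.continuous
    fun_prop
  obtain ⟨M, hM⟩ := isCompact_Icc.exists_bound_of_continuousOn
    (s := Set.Icc (0 : ℝ) 1) hcont.continuousOn
  set L := K * M + K'
  have hsmall : ∀ᶠ β in 𝓝[>] (0 : ℝ), L * β ^ (N + 1) < 1 / 2 := by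
    have h1 : Continuous fun β : ℝ => L * β ^ (N + 1) := by fun_prop
    have h2 : Tendsto (fun β : ℝ => L * β ^ (N + 1)) (𝓝[>] 0) (𝓝 0) := by
      simpa using (h1.tendsto 0).mono_left nhdsWithin_le_nhds
    exact h2.eventually_lt_const (by norm_num)
  refine ⟨2 * L, ?_⟩
  filter_upwards [hK, hsmall, Ioc_mem_nhdsGT one_pos] with β hβ hβs hβ1
  have hmem : β ∈ Set.Icc (0 : ℝ) 1 := ⟨hβ1.1.le, hβ1.2⟩
  -- Since `log f - Q = log (f exp (-Q))`, it suffices that `f exp (-Q)` is close to `1`. This also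
  -- shows `f β ≠ 0` for small `β`, which is not assumed.
  have hu : |f β * Real.exp (-Q.eval β) - 1| ≤ L * β ^ (N + 1) := by
    have hsplit : f β * Real.exp (-Q.eval β) - 1 = (f β - P.eval β) * Real.exp (-Q.eval β) +
        (P.eval β * Real.exp (-Q.eval β) - 1) := by ring
    rw [hsplit]
    refine (abs_add_le _ _).trans ?_
    rw [abs_mul]
    have h1 := hM β hmem
    rw [Real.norm_eq_abs] at h1
    calc _ ≤ K * β ^ (N + 1) * M + K' * β ^ (N + 1) :=
          add_le_add (mul_le_mul hβ h1 (abs_nonneg _) ((abs_nonneg _).trans hβ)) (hK' β hmem)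
      _ = _ := by ring
  have hhalf : 1 / 2 ≤ f β * Real.exp (-Q.eval β) := by
    linarith [(abs_le.1 (hu.trans hβs.le)).1]
  have hf : f β ≠ 0 := by
    rintro h0
    rw [h0, zero_mul] at hhalf
    norm_num at hhalf
  have hlog : Real.log (f β * Real.exp (-Q.eval β)) = Real.log (f β) - Q.eval β := by
    rw [Real.log_mul hf (Real.exp_ne_zero _), Real.log_exp]
    ring
  rw [← hlog]
  refine (abs_log_le_two_mul hhalf).trans ?_
  rw [mul_assoc]
  gcongr

end AsymptoticSeries

/-! ### The expansion of the rescaled density. -/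

section Density

variable {d : ℕ} {a : EuclideanSpace ℝ (Fin d)} {z : ℝ}
  {r : Measure (EuclideanSpace ℝ (Fin d))} [IsProbabilityMeasure r]

/-- Here `b = μt = 1 / (4β)`, and the Gaussian has mass `(π / b)^(d/2)` with `π / b = (β / π)(2π)²`;
so the prefactor and the `(2π)^(-d)` of Fourier inversion combine to the inverse mass. -/
theorem rescaled_density_eq {Φ : ℝ → EuclideanSpace ℝ (Fin d) → ℝ} {β t : ℝ} (hβ : 0 < β)
    (ht : 0 < t) (hz : 0 ≤ z) (hΦ : IsJumpDiffusionDensity (1 / (4 * β * t)) a z r Φ)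
    (φ : EuclideanSpace ℝ (Fin d)) :
    (((β / Real.pi) ^ (-(d : ℝ) / 2) * Φ t φ : ℝ) : ℂ) =
      ((∫ ξ : EuclideanSpace ℝ (Fin d), gaussian (1 / (4 * β)) ξ : ℝ) : ℂ)⁻¹ *
        ∫ ξ, gaussian (1 / (4 * β)) ξ • Complex.exp (phase a z r t φ ξ) := by
  have hpi := Real.pi_pos
  rw [Complex.ofReal_mul, hΦ.eq_gaussian_mean (by positivity) hz ht φ,
    show 1 / (4 * β * t) * t = 1 / (4 * β) by field_simp, ← mul_assoc]
  congr 1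
  rw [← Complex.ofReal_inv, ← Complex.ofReal_mul, integral_gaussian_eq (by positivity)]
  congr 1
  rw [show Real.pi / (1 / (4 * β)) = β / Real.pi * (2 * Real.pi) ^ 2 by field_simp; ring,
    Real.mul_rpow (by positivity) (by positivity), mul_inv, neg_div, Real.rpow_neg (by positivity),
    ← Real.rpow_natCast (2 * Real.pi) 2, ← Real.rpow_mul (by positivity), ← Real.rpow_natCast]
  congr 3
  push_cast
  ring

theorem exists_density_expansion {Φ : ℝ → ℝ → EuclideanSpace ℝ (Fin d) → ℝ}
    (hΦ : ∀ μ : ℝ, 0 < μ → IsJumpDiffusionDensity μ a z r (Φ μ)) (hz : 0 ≤ z)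
    (hr : AnalyticAt ℝ (charFun r) 0) {t : ℝ} (ht : 0 < t) (φ : EuclideanSpace ℝ (Fin d)) (N : ℕ) :
    ∃ K : ℝ, ∀ᶠ β in 𝓝[>] (0 : ℝ),
      |(β / Real.pi) ^ (-(d : ℝ) / 2) * Φ (1 / (4 * β * t)) t φ -
        ∑ m ∈ range (N + 1), β ^ m *
          ((-1) ^ m / (m.factorial : ℝ) * graphSum (vertexWeight a z r t φ) m)| ≤
      K * β ^ (N + 1) := by
  obtain ⟨K, hK⟩ := exists_gaussian_expansion
    (analyticAt_exp_comp (analyticAt_phase a z r t φ hr))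
    (continuous_exp_phase t φ) (norm_exp_phase_le_one hz ht φ) (N + 1)
  -- The remainder is of order `b⁻¹ ^ (N + 1)` with `b⁻¹ = 4β`.
  refine ⟨K * 4 ^ (N + 1), ?_⟩
  filter_upwards [self_mem_nhdsWithin] with β hβ
  have hβ : 0 < β := hβ
  have h := hK (1 / (4 * β)) (by positivity)
  rw [← rescaled_density_eq hβ ht hz (hΦ _ (by positivity)) φ] at h
  have hβc : (β : ℂ) ≠ 0 := by exact_mod_cast hβ.ne'
  have hb : (4 * ((1 / (4 * β) : ℝ) : ℂ))⁻¹ = β := by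
    push_cast
    field_simp
  have hsum : ∑ m ∈ range (N + 1), (4 * ((1 / (4 * β) : ℝ) : ℂ))⁻¹ ^ m * ((m.factorial : ℂ)⁻¹ *
      (sumSecondDeriv (fun i : Fin d => EuclideanSpace.single i (1 : ℝ)))^[m]
        (fun ξ => Complex.exp (phase a z r t φ ξ)) 0) =
      ((∑ m ∈ range (N + 1), β ^ m *
        ((-1) ^ m / (m.factorial : ℝ) * graphSum (vertexWeight a z r t φ) m) : ℝ) : ℂ) := by
    rw [Complex.ofReal_sum]
    refine sum_congr rfl fun m _ => ?_
    rw [hb, iterate_sumSecondDeriv_exp_phase a z r t φ hr]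
    push_cast
    ring
  rw [hsum, ← Complex.ofReal_sub, Complex.norm_real, Real.norm_eq_abs] at h
  refine h.trans_eq ?_
  rw [one_div, inv_inv, mul_pow, mul_assoc]

end Density

end LevyExpansion

/-! ### The main theorem. -/

open LevyExpansion in
open Classical in
theorem theorem3p1 (d : ℕ) (a : EuclideanSpace ℝ (Fin d)) (z : ℝ) (hz : 0 ≤ z)
    (r : Measure (EuclideanSpace ℝ (Fin d))) [IsProbabilityMeasure r] (hr0 : r {0} = 0)
    (hr : AnalyticAt ℝ (charFun r) 0)
    (Φ : ℝ → ℝ → EuclideanSpace ℝ (Fin d) → ℝ)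
    (hΦ : ∀ μ : ℝ, 0 < μ → IsJumpDiffusionDensity μ a z r (Φ μ))
    (t : ℝ) (ht : 0 < t) (φ : EuclideanSpace ℝ (Fin d)) :
    IsAsymptoticSeries
      (fun β => (β / Real.pi) ^ (-(d : ℝ) / 2) * Φ (1 / (4 * β * t)) t φ)
      (fun m => (-1) ^ m / (m.factorial : ℝ) * ∑ G : QGraph m, G.value a z r t φ) ∧
    IsAsymptoticSeries
      (fun β => Real.log ((β / Real.pi) ^ (-(d : ℝ) / 2) * Φ (1 / (4 * β * t)) t φ))
      (fun m => if m = 0 then 0 else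
        (-1) ^ m / (m.factorial : ℝ) *
          ∑ G : QGraph m with G.IsConnected, G.value a z r t φ) := by
  have hexp := exists_density_expansion hΦ hz hr ht φ
  simp only [sum_value]
  refine ⟨isAsymptoticSeries_of_bound hexp, isAsymptoticSeries_log ?_ (if_pos rfl) ?_ hexp⟩
  · simp [graphSum, legs]
  · intro n
    -- After division by factorials, the binomial recursion becomes the one required for the
    -- coefficients of a series and of its logarithm; the signs split as `n + 1 = (k + 1) + (n -
    -- k)`.
    rw [graphSum_succ (vertexWeight_map a z r t φ hr), mul_sum, mul_sum]
    refine sum_congr rfl fun k hk => ?_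
    rw [if_neg k.succ_ne_zero, sum_value_connected a z r t φ k.succ_pos,
      Nat.cast_choose ℝ (Nat.lt_succ_iff.1 (mem_range.1 hk)), Nat.factorial_succ,
      Nat.factorial_succ]
    have hpow : (-1 : ℝ) ^ (n + 1) = (-1) ^ (k + 1) * (-1) ^ (n - k) := by
      rw [← pow_add]
      congr 1
      have := mem_range.1 hk
      omega
    have h1 := n.factorial_ne_zero
    rw [hpow]
    push_cast
    field_simp
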